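/- Let $G=([n],E,w)$ be a finite simple graph with edge weights $w:E\to\mathbb R_{\ge 0}$ and $m=|E|$ edges. Its quantum MAX-CUT Hamiltonian on $n$ qubits is $$\mathcal H(G)=\sum_{e=\{u,v\}\in E} w(e)\, M|_{\{u,v\}}\otimes \mathrm{Id}_{[n]\setminus\{u,v\}},\qquad M=\tfrac12\left(\mathrm{Id}\otimes\mathrm{Id}-X\otimes X-Y\otimes Y-Z\otimes Z\right),$$ where $X,Y,Z$ are the Pauli matrices, and $\mathrm{OPT}(G)=\max_{\|\psi\|_2=1}\langle\psi|\mathcal H(G)|\psi\rangle$. There is an absolute constant $C>0$ such that for every such $G$ and every $\varepsilon>0$ there are a set $L\subseteq E$ with $|L|\le C\varepsilon^{-2}n$ and weights $\tilde w:L\to\mathbb R_{\ge 0}$ such that, with $\tilde G=([n],L,\tilde w)$, every normalized state $|\psi\rangle$ with $$\langle\psi|\mathcal H(\tilde G)|\psi\rangle\ge(1-\varepsilon)\,\mathrm{OPT}(\tilde G)$$ satisfies $$\langle\psi|\mathcal H(G)|\psi\rangle\ge(1-2\varepsilon)\,\mathrm{OPT}(G).$$ Moreover, such a pair $(L,\tilde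 w)$ (with the same constant $C$) can be computed efficiently by a randomized classical algorithm: there is a single real-RAM program with fair coin flips (unit-cost arithmetic and comparisons on real numbers) which, given $n$, $m$, $\varepsilon$ and a list of the edges of $G$ with their weights, always halts within $\mathrm{poly}(n,m)$ steps and outputs a pair $(L,\tilde w)$ with all of the above properties with probability at least $1-2^{-n}$. -/

import Mathlib

open scoped Kronecker

noncomputable section

namespace QMaxCut

/-! ## Quantum MAX-CUT -/

/-- The Pauli matrix `X`. -/
def pauliX : Matrix (Fin 2) (Fin 2) ℂ := !![0, 1; 1, 0]

/-- The Pauli matrix `Y`. -/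
def pauliY : Matrix (Fin 2) (Fin 2) ℂ := !![0, -Complex.I; Complex.I, 0]

/-- The Pauli matrix `Z`. -/
def pauliZ : Matrix (Fin 2) (Fin 2) ℂ := !![1, 0; 0, -1]

/-- The two-qubit predicate matrix `M = (Id ⊗ Id - X ⊗ X - Y ⊗ Y - Z ⊗ Z) / 2`. -/
def pairMatrix : Matrix (Fin 2 × Fin 2) (Fin 2 × Fin 2) ℂ :=
  (1 / 2 : ℂ) •
    ((1 : Matrix (Fin 2) (Fin 2) ℂ) ⊗ₖ (1 : Matrix (Fin 2) (Fin 2) ℂ)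
      - pauliX ⊗ₖ pauliX - pauliY ⊗ₖ pauliY - pauliZ ⊗ₖ pauliZ)

/-- Operators on `n` qubits; the computational basis is indexed by bit strings. -/
abbrev QubitOp (n : ℕ) : Type := Matrix (Fin n → Fin 2) (Fin n → Fin 2) ℂ

/-- Vectors of the `n`-qubit space, with the Euclidean norm. -/
abbrev QubitState (n : ℕ) : Type := EuclideanSpace ℂ (Fin n → Fin 2)

/-- `A|_{u,v} ⊗ Id`: the operator `A` acting on the qubits `u`, `v` (in this order), and the
identity on all other qubits. -/
def onPair {n : ℕ} (A : Matrix (Fin 2 × Fin 2) (Fin 2 × Fin 2) ℂ) (u v : Fin n) : QubitOp n :=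
  open Classical in
  Matrix.of fun x y =>
    if ∀ i, i ≠ u → i ≠ v → x i = y i then A (x u, x v) (y u, y v) else 0

theorem pairMatrix_swap (a b c d : Fin 2) :
    pairMatrix (a, b) (c, d) = pairMatrix (b, a) (d, c) := by
  simp only [pairMatrix, Matrix.smul_apply, Matrix.sub_apply, Matrix.kroneckerMap_apply]
  rw [mul_comm ((1 : Matrix (Fin 2) (Fin 2) ℂ) a c), mul_comm (pauliX a c),
    mul_comm (pauliY a c), mul_comm (pauliZ a c)]

theorem onPair_pairMatrix_swap {n : ℕ} (u v : Fin n) :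
    onPair pairMatrix u v = onPair pairMatrix v u := by
  ext x y
  simp only [onPair, Matrix.of_apply]
  rw [pairMatrix_swap]
  congr 1
  exact propext ⟨fun h i h1 h2 => h i h2 h1, fun h i h1 h2 => h i h2 h1⟩

/-- The Hamiltonian term `M|_{u,v} ⊗ Id` of the edge `{u, v}`. -/
def edgeTerm {n : ℕ} : Sym2 (Fin n) → QubitOp n :=
  Sym2.lift ⟨fun u v => onPair pairMatrix u v, onPair_pairMatrix_swap⟩

/-- `H(G) = ∑_{e ∈ E} w(e) · M|_e ⊗ Id`, for the weighted graph `G = ([n], E, w)`. -/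
def hamiltonian {n : ℕ} (E : Finset (Sym2 (Fin n))) (w : Sym2 (Fin n) → ℝ) : QubitOp n :=
  ∑ e ∈ E, (w e : ℂ) • edgeTerm e

/-- The energy `⟨ψ| H |ψ⟩` (a real number, because `H` is Hermitian wherever it is used). -/
def energy {n : ℕ} (H : QubitOp n) (ψ : QubitState n) : ℝ :=
  (star (WithLp.ofLp ψ) ⬝ᵥ H.mulVec (WithLp.ofLp ψ)).re

/-- `OPT(G)`: the maximum energy over all normalized states. -/
def opt {n : ℕ} (E : Finset (Sym2 (Fin n))) (w : Sym2 (Fin n) → ℝ) : ℝ :=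
  sSup {x : ℝ | ∃ ψ : QubitState n, ‖ψ‖ = 1 ∧ energy (hamiltonian E w) ψ = x}

/-- `([n], L, w')` is a reweighted subgraph of `([n], E, w)` with at most `C ε⁻² n` edges, each of
whose `(1 - ε)`-optimal states is a `(1 - 2ε)`-optimal state of `([n], E, w)`. -/
structure IsSparsification {n : ℕ} (C ε : ℝ) (E : Finset (Sym2 (Fin n)))
    (w : Sym2 (Fin n) → ℝ) (L : Finset (Sym2 (Fin n))) (w' : Sym2 (Fin n) → ℝ) : Prop where
  subset : L ⊆ E
  nonneg : ∀ e ∈ L, 0 ≤ w' e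
  card_le : (L.card : ℝ) ≤ C * ε⁻¹ ^ 2 * n
  near_opt : ∀ ψ : QubitState n, ‖ψ‖ = 1 →
    (1 - ε) * opt L w' ≤ energy (hamiltonian L w') ψ →
    (1 - 2 * ε) * opt E w ≤ energy (hamiltonian E w) ψ

/-! ## A randomized real RAM

Weights and `ε` are arbitrary reals, so running time is counted on a real RAM: a random access
machine with integer and real registers and arrays, unit cost arithmetic and comparisons, and an
instruction that flips a fair coin. There is no rounding of reals, and no integer
multiplication. -/

/-- The store. Registers and arrays are numbered; a program can name only finitely many of them.
`coins` is the sequence of random bits, of which the first `used` have been read. -/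
structure Store where
  ireg : ℕ → ℕ
  rreg : ℕ → ℝ
  imem : ℕ → ℕ → ℕ
  rmem : ℕ → ℕ → ℝ
  coins : ℕ → Bool
  used : ℕ

/-- Elementary instructions; the first argument is the target (for the two store instructions:
the array, followed by the register that holds the index). -/
inductive Instr where
  | iconst (a c : ℕ)
  | iadd (a b c : ℕ)
  | isub (a b c : ℕ)
  | iload (a arr b : ℕ)
  | istore (arr a b : ℕ)
  | rconst (a : ℕ) (q : ℚ)
  | rofnat (a b : ℕ)
  | radd (a b c : ℕ)
  | rsub (a b c : ℕ)
  | rmul (a b c : ℕ)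
  | rdiv (a b c : ℕ)
  | rload (a arr b : ℕ)
  | rstore (arr a b : ℕ)
  | flip (a : ℕ)

/-- The effect of an elementary instruction. Integer subtraction is truncated at `0`, and
division by `0` gives `0`. -/
def Instr.apply : Instr → Store → Store
  | .iconst a c, s => { s with ireg := Function.update s.ireg a c }
  | .iadd a b c, s => { s with ireg := Function.update s.ireg a (s.ireg b + s.ireg c) }
  | .isub a b c, s => { s with ireg := Function.update s.ireg a (s.ireg b - s.ireg c) }
  | .iload a arr b, s => { s with ireg := Function.update s.ireg a (s.imem arr (s.ireg b)) }
  | .istore arr a b, s =>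
      { s with imem :=
          Function.update s.imem arr (Function.update (s.imem arr) (s.ireg a) (s.ireg b)) }
  | .rconst a q, s => { s with rreg := Function.update s.rreg a (q : ℝ) }
  | .rofnat a b, s => { s with rreg := Function.update s.rreg a (s.ireg b : ℝ) }
  | .radd a b c, s => { s with rreg := Function.update s.rreg a (s.rreg b + s.rreg c) }
  | .rsub a b c, s => { s with rreg := Function.update s.rreg a (s.rreg b - s.rreg c) }
  | .rmul a b c, s => { s with rreg := Function.update s.rreg a (s.rreg b * s.rreg c) }
  | .rdiv a b c, s => { s with rreg := Function.update s.rreg a (s.rreg b / s.rreg c) }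
  | .rload a arr b, s => { s with rreg := Function.update s.rreg a (s.rmem arr (s.ireg b)) }
  | .rstore arr a b, s =>
      { s with rmem :=
          Function.update s.rmem arr (Function.update (s.rmem arr) (s.ireg a) (s.rreg b)) }
  | .flip a, s =>
      { s with
        ireg := Function.update s.ireg a (if s.coins s.used = true then 1 else 0)
        used := s.used + 1 }

/-- Tests for branching: comparison of two integer registers or of two real registers. -/
inductive Test where
  | ilt (a b : ℕ)
  | rlt (a b : ℕ)

/-- Truth of a test in a store. -/
def Test.Holds : Test → Store → Prop
  | .ilt a b, s => s.ireg a < s.ireg b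
  | .rlt a b, s => s.rreg a < s.rreg b

/-- Programs. -/
inductive Program where
  | instr (i : Instr)
  | seq (P Q : Program)
  | cond (b : Test) (P Q : Program)
  | loop (b : Test) (P : Program)

/-- `Runs P s t s'`: started in the store `s`, the program `P` halts after exactly `t` steps, in
the store `s'`. Every elementary instruction and every evaluation of a test is one step. -/
inductive Runs : Program → Store → ℕ → Store → Prop where
  | instr (i : Instr) (s : Store) : Runs (.instr i) s 1 (i.apply s)
  | seq {P Q : Program} {s₁ s₂ s₃ : Store} {t₁ t₂ : ℕ} :
      Runs P s₁ t₁ s₂ → Runs Q s₂ t₂ s₃ → Runs (.seq P Q) s₁ (t₁ + t₂) s₃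
  | cond_true {b : Test} {P Q : Program} {s s' : Store} {t : ℕ} :
      b.Holds s → Runs P s t s' → Runs (.cond b P Q) s (1 + t) s'
  | cond_false {b : Test} {P Q : Program} {s s' : Store} {t : ℕ} :
      ¬ b.Holds s → Runs Q s t s' → Runs (.cond b P Q) s (1 + t) s'
  | loop_done {b : Test} {P : Program} {s : Store} :
      ¬ b.Holds s → Runs (.loop b P) s 1 s
  | loop_step {b : Test} {P : Program} {s₁ s₂ s₃ : Store} {t₁ t₂ : ℕ} :
      b.Holds s₁ → Runs P s₁ t₁ s₂ → Runs (.loop b P) s₂ t₂ s₃ →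
        Runs (.loop b P) s₁ (1 + t₁ + t₂) s₃

/-- The probability of an event about a sequence of fair coins that depends on the first `T` coins
only: the fraction of the `2 ^ T` outcomes of these coins for which it holds. -/
def coinProb (T : ℕ) (p : (ℕ → Bool) → Prop) : ℝ :=
  open Classical in
  ((Finset.univ.filter fun r : Fin T → Bool =>
      p fun i => if h : i < T then r ⟨i, h⟩ else false).card : ℝ) / 2 ^ T

/-! ## Input and output -/

/-- `edge 0, …, edge (m - 1)` is a list of the edges of `G`, without repetition. -/
def ListsEdges {n m : ℕ} (G : SimpleGraph (Fin n)) (edge : Fin m → Fin n × Fin n) : Prop :=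
  (Function.Injective fun i => s((edge i).1, (edge i).2)) ∧
    (Set.range fun i => s((edge i).1, (edge i).2)) = G.edgeSet

/-- The initial store: `n` and `m` in the integer registers `0` and `1`, `ε` in the real register
`0`, the endpoints of the edges in the integer arrays `0` and `1`, their weights in the real
array `0`, and `0` everywhere else. -/
def initStore {n m : ℕ} (edge : Fin m → Fin n × Fin n) (w : Sym2 (Fin n) → ℝ) (ε : ℝ)
    (coins : ℕ → Bool) : Store where
  ireg := fun a => if a = 0 then n else if a = 1 then m else 0
  rreg := fun a => if a = 0 then ε else 0
  imem := fun arr i =>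
    if h : i < m then
      if arr = 0 then ((edge ⟨i, h⟩).1 : ℕ) else if arr = 1 then ((edge ⟨i, h⟩).2 : ℕ) else 0
    else 0
  rmem := fun arr i =>
    if h : i < m then
      if arr = 0 then w s((edge ⟨i, h⟩).1, (edge ⟨i, h⟩).2) else 0
    else 0
  coins := coins
  used := 0

/-- The edge set that is output: the `i`-th edge is selected if entry `i` of the integer
array `2` is not `0`. -/
def outEdges {n m : ℕ} (edge : Fin m → Fin n × Fin n) (s : Store) : Finset (Sym2 (Fin n)) :=
  (Finset.univ.filter fun i : Fin m => s.imem 2 i ≠ 0).image fun i => s((edge i).1, (edge i).2)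

/-- The weights that are output: the weight of the `i`-th edge is entry `i` of the real
array `1`. (For a list without repetition, the sum has at most one term.) -/
def outWeights {n m : ℕ} (edge : Fin m → Fin n × Fin n) (s : Store) : Sym2 (Fin n) → ℝ :=
  fun e => ∑ i : Fin m with s((edge i).1, (edge i).2) = e, s.rmem 1 i

end QMaxCut

end

noncomputable section

namespace QMaxCut

/-! Every energy of `H(G)` need only be reproduced up to an additive error `ε W / 4`, where `W` is
the total weight. The term `M` satisfies `M² = 2M`, so energies are nonnegative, and the average of
the energy over the computational basis is `W / 2`, because Pauli matrices are traceless. Hence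
`OPT(G) ≥ W / 2`, and additive errors proportional to `ε W` become relative errors
(`half_sum_le_opt`, `isSparsification_of_close`).

The quantum estimate reduces to a classical one. If edge coefficients `a` sum to zero, the identity
part of `∑ a_e M_e` cancels, leaving one sum of operators `P_u P_v` for each Pauli matrix `P`. For
fixed `P` these operators commute, with the product eigenbasis of `P` diagonalising all of them, so
their combination is bounded by the maximum of `|∑ a_{uv} x_u x_v|` over the `2 ^ n` sign vectors
`x` (`abs_sum_energy_twoSite_le`). The same classical bound serves for `X`, `Y` and `Z`, at the
price of a factor `3 / 2`.

It remains to preserve all signed sums up to `ε W / 6`. Take `k = ⌈4096 n / ε²⌉` independent edges,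
with probabilities nearly proportional to the weights. A Chernoff bound for each sign vector and a
union bound over all of them give failure probability at most `2 · 2 ^ n · exp (-3 n) ≤ 2 ^ (-n)`,
with no logarithmic loss in `k` (`coinProb_sample_ge`). The multiplicities of the sampled edges are
the new weights; the scale `W / k` can be omitted, since near-optimality is invariant under scaling.

The machine draws an edge by comparing a binary fraction made of `2 m` coins, times `W`, with the
prefix sums of the weights; rounding shifts means by at most `m / 2 ^ (2 m)`. It samples only if `ε
< 1 / 2` and `4096 n < m ε²`, which forces `k ≤ m` and so polynomial time. Otherwise the empty graph
(for `ε ≥ 1 / 2`) or all of `G` is a valid output. Existence of a sparsification follows from the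
positive success probability. -/

/-! ## Operators -/

/-- The tensor product of one-qubit operators. -/
def tensor {n : ℕ} (A : Fin n → Matrix (Fin 2) (Fin 2) ℂ) : QubitOp n :=
  Matrix.of fun x y => ∏ i, A i (x i) (y i)

theorem tensor_mul {n : ℕ} (A B : Fin n → Matrix (Fin 2) (Fin 2) ℂ) :
    tensor A * tensor B = tensor fun i => A i * B i := by
  ext x y
  simp only [tensor, Matrix.mul_apply, Matrix.of_apply, ← Finset.prod_mul_distrib]
  exact (Fintype.prod_sum fun i j => A i (x i) j * B i j (y i)).symm

theorem tensor_one {n : ℕ} :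
    tensor (fun _ : Fin n => (1 : Matrix (Fin 2) (Fin 2) ℂ)) = 1 := by
  ext x y
  simp only [tensor, Matrix.of_apply, Matrix.one_apply, Finset.prod_ite_zero,
    Finset.prod_const_one, funext_iff, Finset.mem_univ, true_implies]

theorem tensor_conjTranspose {n : ℕ} (A : Fin n → Matrix (Fin 2) (Fin 2) ℂ) :
    (tensor A).conjTranspose = tensor fun i => (A i).conjTranspose := by
  ext x y
  simp [tensor, Matrix.conjTranspose_apply]

theorem sum_tensor {n : ℕ} {κ : Type*} [Fintype κ]
    (A : Fin n → κ → Matrix (Fin 2) (Fin 2) ℂ) :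
    ∑ s : Fin n → κ, tensor (fun i => A i (s i)) = tensor fun i => ∑ j, A i j := by
  ext x y
  simp only [tensor, Matrix.sum_apply, Matrix.of_apply]
  exact (Fintype.prod_sum fun i j => A i j (x i) (y i)).symm

theorem trace_tensor {n : ℕ} (A : Fin n → Matrix (Fin 2) (Fin 2) ℂ) :
    (tensor A).trace = ∏ i, (A i).trace := by
  simp only [tensor, Matrix.trace, Matrix.diag_apply, Matrix.of_apply]
  exact (Fintype.prod_sum fun i j => A i j j).symm

theorem tensor_smul {n : ℕ} (c : Fin n → ℂ) (A : Fin n → Matrix (Fin 2) (Fin 2) ℂ) :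
    tensor (fun i => c i • A i) = (∏ i, c i) • tensor A := by
  ext x y
  simp [tensor, Finset.prod_mul_distrib]

/-- The operator `P ⊗ P` on the qubits `u`, `v`. -/
def twoSite {n : ℕ} (P : Matrix (Fin 2) (Fin 2) ℂ) (u v : Fin n) : QubitOp n :=
  tensor fun i => if i = u ∨ i = v then P else 1

theorem prod_two {n : ℕ} {M : Type*} [CommMonoid M] {u v : Fin n} (h : u ≠ v) (f : Fin n → M) :
    ∏ i, (if i = u ∨ i = v then f i else 1) = f u * f v := by
  rw [Finset.prod_ite, Finset.prod_const_one, mul_one]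
  have : (Finset.univ.filter fun i => i = u ∨ i = v) = {u, v} := by ext; simp
  rw [this, Finset.prod_pair h]

theorem twoSite_mul {n : ℕ} (P Q : Matrix (Fin 2) (Fin 2) ℂ) (u v : Fin n) :
    twoSite P u v * twoSite Q u v = twoSite (P * Q) u v := by
  simp only [twoSite, tensor_mul]
  congr 1
  ext1 i
  split_ifs <;> simp

/-- Each of the two sites contributes a factor `c`. For `c = ±i` this produces the sign in `(X ⊗
X)(Y ⊗ Y) = -(Z ⊗ Z)`. -/
theorem twoSite_smul {n : ℕ} (c : ℂ) (P : Matrix (Fin 2) (Fin 2) ℂ) {u v : Fin n} (h : u ≠ v) :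
    twoSite (c • P) u v = (c * c) • twoSite P u v := by
  rw [twoSite, twoSite, ← prod_two h fun _ => c, ← tensor_smul]
  congr 1
  ext1 i
  split_ifs <;> simp

theorem twoSite_one {n : ℕ} (u v : Fin n) : twoSite 1 u v = 1 := by
  simp [twoSite, tensor_one]

theorem twoSite_conjTranspose {n : ℕ} {P : Matrix (Fin 2) (Fin 2) ℂ} (hP : P.conjTranspose = P)
    (u v : Fin n) : (twoSite P u v).conjTranspose = twoSite P u v := by
  rw [twoSite, tensor_conjTranspose]
  congr 1
  ext1 i
  split_ifs <;> simp [hP]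

theorem onPair_kronecker {n : ℕ} (P : Matrix (Fin 2) (Fin 2) ℂ) {u v : Fin n} (h : u ≠ v) :
    onPair (P ⊗ₖ P) u v = twoSite P u v := by
  ext x y
  simp only [onPair, twoSite, tensor, Matrix.of_apply, Matrix.kroneckerMap_apply]
  -- Separates the entry of `P` at the two sites from the Kronecker delta at the others, so that the
  -- product over all qubits factors.
  have : ∀ i, (if i = u ∨ i = v then P else 1) (x i) (y i)
      = (if i = u ∨ i = v then P (x i) (y i) else 1)
        * (if i = u ∨ i = v ∨ x i = y i then 1 else 0) := by
    intro i
    by_cases h1 : i = u <;> by_cases h2 : i = v <;> simp [h1, h2, Matrix.one_apply]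
  simp only [this, Finset.prod_mul_distrib, prod_two h fun i => P (x i) (y i),
    Finset.prod_ite_zero, Finset.prod_const_one, Finset.mem_univ, true_implies]
  by_cases hc : ∀ i, i ≠ u → i ≠ v → x i = y i
  · rw [if_pos hc, if_pos (fun i => by have := hc i; tauto), mul_one]
  · rw [if_neg hc, if_neg (fun h' => hc fun i => by have := h' i; tauto), mul_zero]

theorem edgeTerm_eq {n : ℕ} {u v : Fin n} (h : u ≠ v) :
    edgeTerm s(u, v) = (1 / 2 : ℂ) •
      (1 - twoSite pauliX u v - twoSite pauliY u v - twoSite pauliZ u v) := by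
  rw [← onPair_kronecker _ h, ← onPair_kronecker _ h, ← onPair_kronecker _ h,
    ← twoSite_one u v, ← onPair_kronecker _ h]
  ext x y
  simp only [edgeTerm, Sym2.lift_mk, onPair, pairMatrix, Matrix.of_apply, Matrix.smul_apply,
    Matrix.sub_apply]
  split_ifs <;> simp

/-! ### Pauli relations and the square of an edge term -/

theorem pauliX_conjTranspose : pauliX.conjTranspose = pauliX := by
  ext i j; fin_cases i <;> fin_cases j <;> simp [pauliX]
theorem pauliY_conjTranspose : pauliY.conjTranspose = pauliY := by
  ext i j; fin_cases i <;> fin_cases j <;> simp [pauliY]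
theorem pauliZ_conjTranspose : pauliZ.conjTranspose = pauliZ := by
  ext i j; fin_cases i <;> fin_cases j <;> simp [pauliZ]

theorem pauliX_sq : pauliX * pauliX = 1 := by
  ext i j; fin_cases i <;> fin_cases j <;> simp [pauliX]
theorem pauliY_sq : pauliY * pauliY = 1 := by
  ext i j; fin_cases i <;> fin_cases j <;> simp [pauliY]
theorem pauliZ_sq : pauliZ * pauliZ = 1 := by
  ext i j; fin_cases i <;> fin_cases j <;> simp [pauliZ]

theorem pauliX_mul_pauliY : pauliX * pauliY = Complex.I • pauliZ := by
  ext i j; fin_cases i <;> fin_cases j <;> simp [pauliX, pauliY, pauliZ]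
theorem pauliY_mul_pauliX : pauliY * pauliX = (-Complex.I) • pauliZ := by
  ext i j; fin_cases i <;> fin_cases j <;> simp [pauliX, pauliY, pauliZ]
theorem pauliX_mul_pauliZ : pauliX * pauliZ = (-Complex.I) • pauliY := by
  ext i j; fin_cases i <;> fin_cases j <;> simp [pauliX, pauliY, pauliZ]
theorem pauliZ_mul_pauliX : pauliZ * pauliX = Complex.I • pauliY := by
  ext i j; fin_cases i <;> fin_cases j <;> simp [pauliX, pauliY, pauliZ]
theorem pauliY_mul_pauliZ : pauliY * pauliZ = Complex.I • pauliX := by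
  ext i j; fin_cases i <;> fin_cases j <;> simp [pauliX, pauliY, pauliZ]
theorem pauliZ_mul_pauliY : pauliZ * pauliY = (-Complex.I) • pauliX := by
  ext i j; fin_cases i <;> fin_cases j <;> simp [pauliX, pauliY, pauliZ]

theorem edgeTerm_conjTranspose {n : ℕ} {u v : Fin n} (h : u ≠ v) :
    (edgeTerm s(u, v)).conjTranspose = edgeTerm s(u, v) := by
  simp [edgeTerm_eq h, Matrix.conjTranspose_smul, Matrix.conjTranspose_sub,
    twoSite_conjTranspose pauliX_conjTranspose, twoSite_conjTranspose pauliY_conjTranspose,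
    twoSite_conjTranspose pauliZ_conjTranspose]

/-- The three two-site Pauli operators square to `1`, and the product of two distinct ones is minus
the third, so `(1 - a - b - c)² = 4 (1 - a - b - c)`. This is the source of positivity: an edge term
is half of its own square. -/
theorem edgeTerm_sq {n : ℕ} {u v : Fin n} (h : u ≠ v) :
    edgeTerm s(u, v) * edgeTerm s(u, v) = (2 : ℂ) • edgeTerm s(u, v) := by
  simp only [edgeTerm_eq h, smul_mul_smul_comm, sub_mul, mul_sub, one_mul, mul_one, twoSite_mul,
    pauliX_sq, pauliY_sq, pauliZ_sq, pauliX_mul_pauliY, pauliY_mul_pauliX, pauliX_mul_pauliZ,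
    pauliZ_mul_pauliX, pauliY_mul_pauliZ, pauliZ_mul_pauliY, twoSite_smul _ _ h, twoSite_one,
    neg_mul_neg, Complex.I_mul_I]
  module

/-! ## Energies -/

theorem energy_zero {n : ℕ} (ψ : QubitState n) : energy 0 ψ = 0 := by
  simp [energy]

theorem energy_add {n : ℕ} (H K : QubitOp n) (ψ : QubitState n) :
    energy (H + K) ψ = energy H ψ + energy K ψ := by
  simp [energy, Matrix.add_mulVec, dotProduct_add]

theorem energy_smul {n : ℕ} (c : ℝ) (H : QubitOp n) (ψ : QubitState n) :
    energy ((c : ℂ) • H) ψ = c * energy H ψ := by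
  simp [energy, Matrix.smul_mulVec, dotProduct_smul]

theorem energy_sum {n : ℕ} {ι : Type*} (s : Finset ι) (H : ι → QubitOp n) (ψ : QubitState n) :
    energy (∑ i ∈ s, H i) ψ = ∑ i ∈ s, energy (H i) ψ := by
  classical
  induction s using Finset.induction_on with
  | empty => simp [energy_zero]
  | insert a s ha ih => rw [Finset.sum_insert ha, Finset.sum_insert ha, energy_add, ih]

theorem energy_one {n : ℕ} (ψ : QubitState n) : energy 1 ψ = ‖ψ‖ ^ 2 := by
  rw [energy, Matrix.one_mulVec, EuclideanSpace.norm_sq_eq, dotProduct, Complex.re_sum]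
  refine Finset.sum_congr rfl fun i _ => ?_
  rw [Pi.star_apply, ← Complex.normSq_eq_norm_sq, Complex.normSq_apply]
  simp

open scoped ComplexOrder in
theorem energy_nonneg_of_sq {n : ℕ} {H K : QubitOp n} (h : H = K.conjTranspose * K)
    (ψ : QubitState n) : 0 ≤ energy H ψ := by
  have := (Matrix.posSemidef_conjTranspose_mul_self K).dotProduct_mulVec_nonneg (WithLp.ofLp ψ)
  rw [← h] at this
  exact (Complex.le_def.mp this).1

theorem energy_edgeTerm_nonneg {n : ℕ} {u v : Fin n} (h : u ≠ v) (ψ : QubitState n) :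
    0 ≤ energy (edgeTerm s(u, v)) ψ := by
  have h2 : 0 ≤ energy (((2 : ℝ) : ℂ) • edgeTerm s(u, v)) ψ := by
    apply energy_nonneg_of_sq (K := edgeTerm s(u, v))
    rw [edgeTerm_conjTranspose h, edgeTerm_sq h]
    norm_num
  rw [energy_smul] at h2
  linarith

/-! ### Simultaneous diagonalisation and reduction to sign vectors -/

/-- The sign `±1` of a bit. -/
def sgn (b : Bool) : ℝ := if b then 1 else -1

/-- The projection to the eigenspace of the involution `P` with eigenvalue `sgn b`. -/
def eigenProj (P : Matrix (Fin 2) (Fin 2) ℂ) (b : Bool) : Matrix (Fin 2) (Fin 2) ℂ :=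
  (1 / 2 : ℂ) • (1 + (sgn b : ℂ) • P)

theorem sum_eigenProj (P : Matrix (Fin 2) (Fin 2) ℂ) : ∑ b, eigenProj P b = 1 := by
  simp only [Fintype.sum_bool, eigenProj, sgn]
  norm_num
  module

theorem sum_sgn_smul_eigenProj (P : Matrix (Fin 2) (Fin 2) ℂ) :
    ∑ b, (sgn b : ℂ) • eigenProj P b = P := by
  simp only [Fintype.sum_bool, eigenProj, sgn]
  norm_num
  module

theorem eigenProj_sq {P : Matrix (Fin 2) (Fin 2) ℂ} (hP : P * P = 1) (b : Bool) :
    eigenProj P b * eigenProj P b = eigenProj P b := by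
  cases b <;> simp only [eigenProj, sgn, smul_mul_smul_comm, mul_add, add_mul, hP, one_mul,
    mul_one] <;> norm_num <;> module

theorem eigenProj_conjTranspose {P : Matrix (Fin 2) (Fin 2) ℂ} (hP : P.conjTranspose = P)
    (b : Bool) : (eigenProj P b).conjTranspose = eigenProj P b := by
  simp [eigenProj, Matrix.conjTranspose_smul, hP]

/-- Spectral decomposition in a basis that does not depend on the pair: expand `P` in its
eigenprojections at `u` and `v`, expand `1` likewise at all other sites, and multiply out. -/
theorem twoSite_eq_sum {n : ℕ} (P : Matrix (Fin 2) (Fin 2) ℂ) {u v : Fin n} (h : u ≠ v) :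
    twoSite P u v = ∑ x : Fin n → Bool,
      ((sgn (x u) * sgn (x v) : ℝ) : ℂ) • tensor fun i => eigenProj P (x i) := by
  have h1 : ∀ x : Fin n → Bool,
      ((sgn (x u) * sgn (x v) : ℝ) : ℂ) • tensor (fun i => eigenProj P (x i))
        = tensor fun i => (if i = u ∨ i = v then (sgn (x i) : ℂ) else 1) • eigenProj P (x i) := by
    intro x
    rw [tensor_smul, prod_two h fun i => (sgn (x i) : ℂ)]
    norm_num
  simp only [h1]
  rw [sum_tensor fun i b => (if i = u ∨ i = v then (sgn b : ℂ) else 1) • eigenProj P b, twoSite]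
  congr 1
  ext1 i
  split_ifs
  · rw [sum_sgn_smul_eigenProj]
  · simp only [one_smul, sum_eigenProj]

theorem sum_tensor_eigenProj {n : ℕ} (P : Matrix (Fin 2) (Fin 2) ℂ) :
    ∑ x : Fin n → Bool, tensor (fun i => eigenProj P (x i)) = 1 := by
  rw [sum_tensor fun _ b => eigenProj P b]
  simp only [sum_eigenProj, tensor_one]

/-- A combination of the commuting operators `P_u P_v` is bounded by its largest value on sign
vectors. -/
theorem abs_sum_energy_twoSite_le {n : ℕ} {ι : Type*} [Fintype ι] {P : Matrix (Fin 2) (Fin 2) ℂ}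
    (hP : P.conjTranspose = P) (hP2 : P * P = 1) (e : ι → Fin n × Fin n)
    (he : ∀ i, (e i).1 ≠ (e i).2) (a : ι → ℝ) {B : ℝ}
    (hB : ∀ x : Fin n → Bool, |∑ i, a i * (sgn (x (e i).1) * sgn (x (e i).2))| ≤ B)
    {ψ : QubitState n} (hψ : ‖ψ‖ = 1) :
    |∑ i, a i * energy (twoSite P (e i).1 (e i).2) ψ| ≤ B := by
  -- The outcome distribution of measuring every qubit of `ψ` in the eigenbasis of `P`; the sum to
  -- be bounded is an expectation under it.
  set p : (Fin n → Bool) → ℝ := fun x => energy (tensor fun i => eigenProj P (x i)) ψ with hp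
  have hp0 : ∀ x, 0 ≤ p x := by
    intro x
    apply energy_nonneg_of_sq (K := tensor fun i => eigenProj P (x i))
    simp only [tensor_conjTranspose, eigenProj_conjTranspose hP, tensor_mul, eigenProj_sq hP2]
  have hp1 : ∑ x, p x = 1 := by
    rw [hp, ← energy_sum, sum_tensor_eigenProj, energy_one, hψ, one_pow]
  have h1 : ∑ i, a i * energy (twoSite P (e i).1 (e i).2) ψ
      = ∑ x, (∑ i, a i * (sgn (x (e i).1) * sgn (x (e i).2))) * p x := by
    simp only [Finset.sum_mul]
    rw [Finset.sum_comm]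
    refine Finset.sum_congr rfl fun i _ => ?_
    rw [twoSite_eq_sum P (he i), energy_sum, Finset.mul_sum]
    refine Finset.sum_congr rfl fun x _ => ?_
    rw [energy_smul]
    ring
  rw [h1]
  calc _ ≤ ∑ x, |(∑ i, a i * (sgn (x (e i).1) * sgn (x (e i).2))) * p x| :=
        Finset.abs_sum_le_sum_abs _ _
    _ ≤ ∑ x, B * p x := by
        refine Finset.sum_le_sum fun x _ => ?_
        rw [abs_mul, abs_of_nonneg (hp0 x)]
        exact mul_le_mul_of_nonneg_right (hB x) (hp0 x)
    _ = B := by rw [← Finset.mul_sum, hp1, mul_one]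

theorem energy_edgeTerm {n : ℕ} {u v : Fin n} (h : u ≠ v) (ψ : QubitState n) :
    energy (edgeTerm s(u, v)) ψ = 1 / 2 * (‖ψ‖ ^ 2 - energy (twoSite pauliX u v) ψ
      - energy (twoSite pauliY u v) ψ - energy (twoSite pauliZ u v) ψ) := by
  have : edgeTerm s(u, v) = ((1 / 2 : ℝ) : ℂ) • (1 + ((-1 : ℝ) : ℂ) • twoSite pauliX u v
      + ((-1 : ℝ) : ℂ) • twoSite pauliY u v + ((-1 : ℝ) : ℂ) • twoSite pauliZ u v) := by
    rw [edgeTerm_eq h]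
    push_cast
    module
  rw [this]
  simp only [energy_smul, energy_add, energy_one]
  ring

/-- Since the coefficients sum to zero the identity parts cancel; three Pauli sums remain, each at
most `B` in absolute value, with the prefactor `1 / 2`. -/
theorem abs_sum_energy_edgeTerm_le {n : ℕ} {ι : Type*} [Fintype ι] (e : ι → Fin n × Fin n)
    (he : ∀ i, (e i).1 ≠ (e i).2) (a : ι → ℝ) (ha : ∑ i, a i = 0) {B : ℝ}
    (hB : ∀ x : Fin n → Bool, |∑ i, a i * (sgn (x (e i).1) * sgn (x (e i).2))| ≤ B)
    {ψ : QubitState n} (hψ : ‖ψ‖ = 1) :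
    |∑ i, a i * energy (edgeTerm s((e i).1, (e i).2)) ψ| ≤ 3 / 2 * B := by
  have hX := abs_sum_energy_twoSite_le pauliX_conjTranspose pauliX_sq e he a hB hψ
  have hY := abs_sum_energy_twoSite_le pauliY_conjTranspose pauliY_sq e he a hB hψ
  have hZ := abs_sum_energy_twoSite_le pauliZ_conjTranspose pauliZ_sq e he a hB hψ
  have h1 : ∑ i, a i * energy (edgeTerm s((e i).1, (e i).2)) ψ
      = 1 / 2 * (∑ i, a i - ∑ i, a i * energy (twoSite pauliX (e i).1 (e i).2) ψ
        - ∑ i, a i * energy (twoSite pauliY (e i).1 (e i).2) ψ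
        - ∑ i, a i * energy (twoSite pauliZ (e i).1 (e i).2) ψ) := by
    simp only [← Finset.sum_sub_distrib, Finset.mul_sum]
    refine Finset.sum_congr rfl fun i _ => ?_
    rw [energy_edgeTerm (he i), hψ]
    ring
  rw [h1, ha]
  rw [abs_le] at *
  constructor <;> linarith [hX.1, hX.2, hY.1, hY.2, hZ.1, hZ.2]

/-- The sign-vector bound for a single edge. It serves to show that the set of energies in `opt` is
bounded, without which its `sSup` would be useless. -/
theorem energy_edgeTerm_le {n : ℕ} {u v : Fin n} (h : u ≠ v) {ψ : QubitState n} (hψ : ‖ψ‖ = 1) :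
    energy (edgeTerm s(u, v)) ψ ≤ 2 := by
  have hB : ∀ x : Fin n → Bool, |∑ _i : Unit, (1 : ℝ) * (sgn (x u) * sgn (x v))| ≤ 1 := by
    intro x
    cases h1 : x u <;> cases h2 : x v <;> simp [sgn]
  have key := fun (P) (hP : Matrix.conjTranspose P = P) (hP2 : P * P = 1) =>
    abs_sum_energy_twoSite_le hP hP2 (fun _ : Unit => (u, v)) (fun _ => h) (fun _ => 1) hB hψ
  have hX := key _ pauliX_conjTranspose pauliX_sq
  have hY := key _ pauliY_conjTranspose pauliY_sq
  have hZ := key _ pauliZ_conjTranspose pauliZ_sq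
  simp only [Finset.univ_unique, Finset.sum_singleton, one_mul, abs_le] at hX hY hZ
  rw [energy_edgeTerm h, hψ]
  linarith [hX.1, hY.1, hZ.1]

/-! ## The optimum -/

theorem energy_hamiltonian {n : ℕ} (E : Finset (Sym2 (Fin n))) (w : Sym2 (Fin n) → ℝ)
    (ψ : QubitState n) :
    energy (hamiltonian E w) ψ = ∑ e ∈ E, w e * energy (edgeTerm e) ψ := by
  simp only [hamiltonian, energy_sum, energy_smul]

theorem energy_hamiltonian_nonneg {n : ℕ} {E : Finset (Sym2 (Fin n))} {w : Sym2 (Fin n) → ℝ}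
    (hE : ∀ e ∈ E, ¬ e.IsDiag) (hw : ∀ e ∈ E, 0 ≤ w e) (ψ : QubitState n) :
    0 ≤ energy (hamiltonian E w) ψ := by
  rw [energy_hamiltonian]
  refine Finset.sum_nonneg fun e he => mul_nonneg (hw e he) ?_
  have := hE e he
  induction e using Sym2.ind with
  | _ u v => exact energy_edgeTerm_nonneg (by simpa using this) ψ

theorem le_opt {n : ℕ} {E : Finset (Sym2 (Fin n))} {w : Sym2 (Fin n) → ℝ}
    (hE : ∀ e ∈ E, ¬ e.IsDiag) (hw : ∀ e ∈ E, 0 ≤ w e) {ψ : QubitState n} (hψ : ‖ψ‖ = 1) :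
    energy (hamiltonian E w) ψ ≤ opt E w := by
  refine le_csSup ⟨∑ e ∈ E, w e * 2, ?_⟩ ⟨ψ, hψ, rfl⟩
  rintro x ⟨φ, hφ, rfl⟩
  rw [energy_hamiltonian]
  refine Finset.sum_le_sum fun e he => mul_le_mul_of_nonneg_left ?_ (hw e he)
  have := hE e he
  induction e using Sym2.ind with
  | _ u v => exact energy_edgeTerm_le (by simpa using this) hφ

theorem energy_single {n : ℕ} (H : QubitOp n) (x : Fin n → Fin 2) :
    energy H (EuclideanSpace.single x 1) = (H x x).re := by
  classical
  simp [energy, EuclideanSpace.single, Pi.star_single]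

theorem opt_le {n : ℕ} {E : Finset (Sym2 (Fin n))} {w : Sym2 (Fin n) → ℝ} {B : ℝ}
    (h : ∀ ψ : QubitState n, ‖ψ‖ = 1 → energy (hamiltonian E w) ψ ≤ B) : opt E w ≤ B := by
  -- A basis state shows that the set of energies is nonempty, also for `n = 0`.
  refine csSup_le ⟨_, EuclideanSpace.single (fun _ => 0) 1, by simp, rfl⟩ ?_
  rintro x ⟨φ, hφ, rfl⟩
  exact h φ hφ

theorem trace_edgeTerm {n : ℕ} {u v : Fin n} (h : u ≠ v) :
    (edgeTerm s(u, v)).trace = 2 ^ n / 2 := by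
  have h0 : ∀ P : Matrix (Fin 2) (Fin 2) ℂ, P.trace = 0 → (twoSite P u v).trace = 0 := by
    intro P hP
    rw [twoSite, trace_tensor]
    exact Finset.prod_eq_zero (Finset.mem_univ u) (by simp [hP])
  rw [edgeTerm_eq h]
  simp only [Matrix.trace_smul, Matrix.trace_sub, Matrix.trace_one]
  rw [h0 _ (by simp [pauliX, Matrix.trace_fin_two]), h0 _ (by simp [pauliY, Matrix.trace_fin_two]),
    h0 _ (by simp [pauliZ, Matrix.trace_fin_two])]
  simp
  ring

/-- Averaging over the computational basis gives the normalized trace of the Hamiltonian, and the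
optimum is at least the average. -/
theorem half_sum_le_opt {n : ℕ} {E : Finset (Sym2 (Fin n))} {w : Sym2 (Fin n) → ℝ}
    (hE : ∀ e ∈ E, ¬ e.IsDiag) (hw : ∀ e ∈ E, 0 ≤ w e) :
    (∑ e ∈ E, w e) / 2 ≤ opt E w := by
  have h1 : ∑ x : Fin n → Fin 2, energy (hamiltonian E w) (EuclideanSpace.single x 1)
      = 2 ^ n * ((∑ e ∈ E, w e) / 2) := by
    simp only [energy_single]
    rw [← Complex.re_sum]
    have : ∑ x, hamiltonian E w x x = (hamiltonian E w).trace := rfl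
    rw [this, hamiltonian, Matrix.trace_sum]
    have h2 : ∀ e ∈ E, ((w e : ℂ) • edgeTerm e).trace = ((w e * (2 ^ n / 2) : ℝ) : ℂ) := by
      intro e he
      have := hE e he
      induction e using Sym2.ind with
      | _ u v =>
        rw [Matrix.trace_smul, trace_edgeTerm (by simpa using this)]
        simp
    rw [Finset.sum_congr rfl h2, ← Complex.ofReal_sum, Complex.ofReal_re, ← Finset.sum_mul]
    ring
  have h2 : ∑ x : Fin n → Fin 2, energy (hamiltonian E w) (EuclideanSpace.single x 1)
      ≤ 2 ^ n * opt E w := by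
    calc _ ≤ ∑ _x : Fin n → Fin 2, opt E w :=
          Finset.sum_le_sum fun x _ => le_opt hE hw (by simp)
      _ = 2 ^ n * opt E w := by simp
  rw [h1] at h2
  exact le_of_mul_le_mul_left h2 (by positivity)

theorem opt_nonneg {n : ℕ} {E : Finset (Sym2 (Fin n))} {w : Sym2 (Fin n) → ℝ}
    (hE : ∀ e ∈ E, ¬ e.IsDiag) (hw : ∀ e ∈ E, 0 ≤ w e) : 0 ≤ opt E w :=
  le_trans (by have := Finset.sum_nonneg hw; positivity) (half_sum_le_opt hE hw)

/-! ## Sparsifications -/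

theorem isSparsification_self {n : ℕ} {C ε : ℝ} (hε : 0 < ε) {E : Finset (Sym2 (Fin n))}
    {w w' : Sym2 (Fin n) → ℝ} (hE : ∀ e ∈ E, ¬ e.IsDiag) (hw : ∀ e ∈ E, 0 ≤ w e)
    (hw' : ∀ e ∈ E, w' e = w e) (hc : (E.card : ℝ) ≤ C * ε⁻¹ ^ 2 * n) :
    IsSparsification C ε E w E w' := by
  have hH : hamiltonian E w' = hamiltonian E w :=
    Finset.sum_congr rfl fun e he => by rw [hw' e he]
  refine ⟨subset_rfl, fun e he => (hw' e he).symm ▸ hw e he, hc, fun ψ _ h => ?_⟩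
  rw [hH, opt, hH] at h
  change (1 - ε) * opt E w ≤ _ at h
  nlinarith [opt_nonneg hE hw]

/-- For `ε ≥ 1 / 2` the factor `1 - 2 ε` is not positive, so every state meets the target. -/
theorem isSparsification_empty {n : ℕ} {C ε : ℝ} (hC : 0 ≤ C) (hε : 1 / 2 ≤ ε)
    {E : Finset (Sym2 (Fin n))} {w : Sym2 (Fin n) → ℝ} (w' : Sym2 (Fin n) → ℝ)
    (hE : ∀ e ∈ E, ¬ e.IsDiag) (hw : ∀ e ∈ E, 0 ≤ w e) : IsSparsification C ε E w ∅ w' := by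
  refine ⟨Finset.empty_subset _, by simp, ?_, fun ψ _ _ => ?_⟩
  · have : 0 < ε := by linarith
    simp only [Finset.card_empty, Nat.cast_zero]
    positivity
  · have := opt_nonneg hE hw
    have := energy_hamiltonian_nonneg hE hw ψ
    nlinarith

/-- A reweighted subgraph whose Hamiltonian is, up to a factor `lam`, within `ε W / 4` of that of
the graph of total weight `W`. -/
theorem isSparsification_of_close {n : ℕ} {C ε lam : ℝ} (hε : 0 < ε) (hε1 : ε ≤ 1)
    (hlam : 0 ≤ lam) {E L : Finset (Sym2 (Fin n))} {w w' : Sym2 (Fin n) → ℝ}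
    (hE : ∀ e ∈ E, ¬ e.IsDiag) (hw : ∀ e ∈ E, 0 ≤ w e) (hL : L ⊆ E) (hw' : ∀ e ∈ L, 0 ≤ w' e)
    (hc : (L.card : ℝ) ≤ C * ε⁻¹ ^ 2 * n)
    (hclose : ∀ ψ : QubitState n, ‖ψ‖ = 1 →
      |lam * energy (hamiltonian L w') ψ - energy (hamiltonian E w) ψ|
        ≤ ε / 4 * ∑ e ∈ E, w e) :
    IsSparsification C ε E w L w' := by
  refine ⟨hL, hw', hc, fun ψ hψ h => ?_⟩
  set W := ∑ e ∈ E, w e with hW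
  have hW0 : 0 ≤ W := Finset.sum_nonneg hw
  have hhalf : W / 2 ≤ opt E w := half_sum_le_opt hE hw
  -- Near-optimality of `ψ` for the subgraph compares it with every competitor `φ`. Passing to `G`
  -- costs `ε W / 4` once for `φ` and once for `ψ`.
  have key : ∀ φ : QubitState n, ‖φ‖ = 1 →
      (1 - ε) * energy (hamiltonian E w) φ ≤ energy (hamiltonian E w) ψ + ε / 2 * W := by
    intro φ hφ
    have h1 := le_opt (fun e he => hE e (hL he)) hw' hφ
    have h2 : (1 - ε) * energy (hamiltonian L w') φ ≤ energy (hamiltonian L w') ψ :=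
      (mul_le_mul_of_nonneg_left h1 (by linarith)).trans h
    have h3 := mul_le_mul_of_nonneg_left h2 hlam
    have h4 := (abs_le.mp (hclose φ hφ)).1
    have h5 := (abs_le.mp (hclose ψ hψ)).2
    have h6 := mul_le_mul_of_nonneg_left h4 (by linarith : (0 : ℝ) ≤ 1 - ε)
    nlinarith [mul_nonneg hε.le hW0, mul_nonneg hε.le (mul_nonneg hε.le hW0)]
  rcases hε1.lt_or_eq with h1 | h1
  · have : opt E w ≤ (energy (hamiltonian E w) ψ + ε / 2 * W) / (1 - ε) :=
      opt_le fun φ hφ => by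
        rw [le_div_iff₀ (by linarith), mul_comm]
        exact key φ hφ
    rw [le_div_iff₀ (by linarith)] at this
    nlinarith
  -- At `ε = 1` division by `1 - ε` is impossible, but the target `-opt E w` is trivial.
  · have := energy_hamiltonian_nonneg hE hw ψ
    rw [h1]
    linarith

/-! ## A Chernoff bound for uniform choices from a finite set -/

theorem card_filter_le_of_exp {κ : Type*} [Fintype κ] (X : κ → ℝ) (c : ℝ) :
    ((Finset.univ.filter fun a => c ≤ X a).card : ℝ) ≤ Real.exp (-c) * ∑ a, Real.exp (X a) := by
  rw [Finset.mul_sum, Finset.card_filter, Nat.cast_sum]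
  refine Finset.sum_le_sum fun a _ => ?_
  rw [← Real.exp_add]
  split_ifs with h
  · simpa using h
  · simpa using (Real.exp_pos _).le

/-- Exponential moments, with counting in place of probability. The mean may be as large as `t / 4`
instead of zero, which leaves room for the rounding bias of the sampler. -/
theorem card_sum_ge_le {Ω : Type*} [Fintype Ω] (g : Ω → ℝ) (hg : ∀ a, |g a| ≤ 2) {t : ℝ}
    (ht : 0 ≤ t) (ht1 : t ≤ 1) (hmean : ∑ a, g a ≤ t / 4 * Fintype.card Ω) (k : ℕ) :
    ((Finset.univ.filter fun ω : Fin k → Ω => k * t ≤ ∑ j, g (ω j)).card : ℝ)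
      ≤ (Fintype.card Ω : ℝ) ^ k * Real.exp (-(k * t ^ 2 / 32)) := by
  -- With `exp y ≤ 1 + y + y²`, the mean and the quadratic term contribute `t² / 64` each to the
  -- average of `exp (s g)`, so the exponent per sample is `-t² / 16 + t² / 32`.
  set s : ℝ := t / 16 with hs
  have hs0 : 0 ≤ s := by positivity
  have h1 : ∑ a, Real.exp (s * g a) ≤ Fintype.card Ω * Real.exp (t ^ 2 / 32) := by
    have h2 : ∀ a, Real.exp (s * g a) ≤ 1 + s * g a + 4 * s ^ 2 := by
      intro a
      have h3 : |s * g a| ≤ 2 * s := by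
        rw [abs_mul, abs_of_nonneg hs0]
        nlinarith [hg a]
      have h4 := (abs_le.mp (Real.abs_exp_sub_one_sub_id_le
        (h3.trans (by rw [hs]; linarith)))).2
      have h5 : (s * g a) ^ 2 ≤ (2 * s) ^ 2 := sq_le_sq' (abs_le.mp h3).1 (abs_le.mp h3).2
      linarith
    calc ∑ a, Real.exp (s * g a) ≤ ∑ a, (1 + s * g a + 4 * s ^ 2) :=
          Finset.sum_le_sum fun a _ => h2 a
      _ = Fintype.card Ω * (1 + 4 * s ^ 2) + s * ∑ a, g a := by
          simp only [Finset.sum_add_distrib, Finset.mul_sum, Finset.sum_const, nsmul_eq_mul,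
            Finset.card_univ]
          ring
      _ ≤ Fintype.card Ω * (t ^ 2 / 32 + 1) := by
          have := mul_le_mul_of_nonneg_left hmean hs0
          rw [hs] at this ⊢
          linarith
      _ ≤ _ := by gcongr; exact Real.add_one_le_exp _
  have h2 : (Finset.univ.filter fun ω : Fin k → Ω => k * t ≤ ∑ j, g (ω j))
      ⊆ Finset.univ.filter fun ω : Fin k → Ω => s * (k * t) ≤ ∑ j, s * g (ω j) := by
    intro ω hω
    simp only [Finset.mem_filter, Finset.mem_univ, true_and, ← Finset.mul_sum] at hω ⊢
    exact mul_le_mul_of_nonneg_left hω hs0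
  have h3 : ∑ ω : Fin k → Ω, Real.exp (∑ j, s * g (ω j)) = (∑ a, Real.exp (s * g a)) ^ k := by
    simp only [Real.exp_sum]
    rw [← Fintype.prod_sum fun (_ : Fin k) a => Real.exp (s * g a)]
    simp
  calc _ ≤ ((Finset.univ.filter fun ω : Fin k → Ω =>
        s * (k * t) ≤ ∑ j, s * g (ω j)).card : ℝ) := by exact_mod_cast Finset.card_le_card h2
    _ ≤ Real.exp (-(s * (k * t))) * (∑ a, Real.exp (s * g a)) ^ k := by
        rw [← h3]; exact card_filter_le_of_exp _ _
    _ ≤ Real.exp (-(s * (k * t))) * (Fintype.card Ω * Real.exp (t ^ 2 / 32)) ^ k := by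
        gcongr
    _ = _ := by
        rw [mul_pow, ← Real.exp_nat_mul, mul_left_comm, ← Real.exp_add]
        congr 2
        rw [hs]
        ring

/-! ## Blocks of coins -/

/-- The `j`-th block of `b` coins. -/
def coinBlock (b : ℕ) (coins : ℕ → Bool) (j : ℕ) : Fin b → Bool := fun l => coins (j * b + l)

/-- A finite sequence of coins, continued by `false`. -/
def extendCoins {T : ℕ} (r : Fin T → Bool) : ℕ → Bool := fun i =>
  if h : i < T then r ⟨i, h⟩ else false

/-- The first `k * b` coins form independent uniform blocks, and the remaining `T - k * b` coins are
free. -/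
theorem card_coinBlock (k b T : ℕ) (h : k * b ≤ T) (p : (Fin k → Fin b → Bool) → Prop)
    [DecidablePred p] :
    (Finset.univ.filter fun r : Fin T → Bool =>
        p fun j => coinBlock b (extendCoins r) j).card * 2 ^ (k * b)
      = (Finset.univ.filter p).card * 2 ^ T := by
  obtain ⟨c, rfl⟩ := Nat.exists_eq_add_of_le h
  let e : (Fin (k * b + c) → Bool) ≃ (Fin k → Fin b → Bool) × (Fin c → Bool) :=
    ((finSumFinEquiv.symm.arrowCongr (Equiv.refl Bool)).trans
      (Equiv.sumArrowEquivProdArrow _ _ _)).trans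
        (((finProdFinEquiv.symm.arrowCongr (Equiv.refl Bool)).trans
          (Equiv.curry _ _ _)).prodCongr (Equiv.refl _))
  have he : ∀ r : Fin (k * b + c) → Bool,
      (fun j : Fin k => coinBlock b (extendCoins r) j) = (e r).1 := by
    intro r
    ext j l
    have hlt : (j : ℕ) * b + l < k * b := by
      have := j.isLt; have := l.isLt
      calc (j : ℕ) * b + l < (j : ℕ) * b + b := by omega
        _ = (j + 1) * b := by ring
        _ ≤ k * b := Nat.mul_le_mul_right _ (by omega)
    have hlt' : (j : ℕ) * b + l < k * b + c := by omega
    simp only [coinBlock, extendCoins, hlt', dif_pos]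
    simp only [e, Equiv.trans_apply, Equiv.prodCongr_apply, Prod.map, Equiv.curry_apply,
      Function.curry, Equiv.arrowCongr_apply, Equiv.sumArrowEquivProdArrow, Equiv.coe_fn_mk,
      Equiv.coe_refl, Function.comp, Equiv.symm_symm, id, finSumFinEquiv_apply_left]
    congr 1
    ext
    simp [finProdFinEquiv]
    ring
  simp only [he]
  have h1 : (Finset.univ.filter fun r => p (e r).1).card
      = ((Finset.univ.filter p) ×ˢ (Finset.univ : Finset (Fin c → Bool))).card := by
    refine Finset.card_equiv e fun r => ?_
    simp
  rw [h1, Finset.card_product, Finset.card_univ, Fintype.card_fun, Fintype.card_bool,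
    Fintype.card_fin, pow_add]
  ring

/-! ## Random binary fractions -/

/-- The binary fraction with the digits `c 0, …, c (l - 1)`, the last one leading. -/
def bitVal (c : ℕ → Bool) : ℕ → ℝ
  | 0 => 0
  | l + 1 => (bitVal c l + if c l then 1 else 0) * (1 / 2)

theorem bitVal_congr {c c' : ℕ → Bool} {l : ℕ} (h : ∀ i < l, c i = c' i) :
    bitVal c l = bitVal c' l := by
  induction l with
  | zero => rfl
  | succ l ih => rw [bitVal, bitVal, ih fun i hi => h i (by omega), h l (by omega)]

/-- `b` fair coins give the uniform distribution on the multiples of `2 ^ (-b)` in `[0, 1)`. In the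
induction the last coin chooses the half of the interval, and the halving of the rest is absorbed
into `F`. -/
theorem sum_bitVal (b : ℕ) (F : ℝ → ℝ) :
    ∑ c : Fin b → Bool, F (bitVal (extendCoins c) b)
      = ∑ r ∈ Finset.range (2 ^ b), F (r / 2 ^ b) := by
  induction b generalizing F with
  | zero => simp [bitVal]
  | succ b ih =>
    have h1 : ∀ (c : Fin b → Bool) (x : Bool),
        bitVal (extendCoins (Fin.snoc c x : Fin (b + 1) → Bool)) (b + 1)
          = (bitVal (extendCoins c) b + if x then 1 else 0) * (1 / 2) := by
      intro c x
      rw [bitVal]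
      congr 2
      · refine bitVal_congr fun i hi => ?_
        have hi' : i < b + 1 := by omega
        simp only [extendCoins, hi, hi', dif_pos]
        exact Fin.snoc_castSucc (α := fun _ => Bool) x c ⟨i, hi⟩
      · have : extendCoins (Fin.snoc c x : Fin (b + 1) → Bool) b = x := by
          simp only [extendCoins, Nat.lt_succ_self, dif_pos]
          exact Fin.snoc_last (α := fun _ => Bool) x c
        rw [this]
    rw [← (Fin.snocEquiv fun _ : Fin (b + 1) => Bool).sum_comp, Fintype.sum_prod_type,
      Fintype.sum_bool]
    simp only [Fin.snocEquiv, Equiv.coe_fn_mk, h1, if_true, Bool.false_eq_true, if_false]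
    rw [ih fun y => F ((y + 1) * (1 / 2)), ih fun y => F ((y + 0) * (1 / 2)), pow_succ, mul_two,
      Finset.sum_range_add, add_comm]
    congr 1
    · refine Finset.sum_congr rfl fun r _ => ?_
      congr 1
      rw [pow_succ]
      field_simp
      ring
    · refine Finset.sum_congr rfl fun r _ => ?_
      congr 1
      rw [pow_succ]
      push_cast
      field_simp
      ring

/-! ## Sampling from a list of weights -/

/-- The last index below `i` whose prefix sum of weights is at most `τ`. -/
def select (w : ℕ → ℝ) (τ : ℝ) : ℕ → ℕ
  | 0 => 0
  | i + 1 => if τ < ∑ j ∈ Finset.range i, w j then select w τ i else i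

theorem select_lt (w : ℕ → ℝ) (τ : ℝ) {m : ℕ} (hm : 0 < m) : select w τ m < m := by
  induction m with
  | zero => omega
  | succ m ih =>
    rw [select]
    split_ifs with h
    · rcases m.eq_zero_or_pos with rfl | hm'
      · simp [select]
      · have := ih hm'
        omega
    · omega

theorem select_eq {w : ℕ → ℝ} (hw : ∀ j, 0 ≤ w j) {τ : ℝ} {i m : ℕ} (him : i < m)
    (h1 : ∑ j ∈ Finset.range i, w j ≤ τ) (h2 : τ < ∑ j ∈ Finset.range (i + 1), w j) :
    select w τ m = i := by
  induction m with
  | zero => omega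
  | succ m ih =>
    rw [select]
    rcases Nat.lt_succ_iff_lt_or_eq.mp him with h | rfl
    · rw [if_pos (h2.trans_le (Finset.sum_le_sum_of_subset_of_nonneg
        (Finset.range_mono (by omega)) fun j _ _ => hw j)), ih h]
    · rw [if_neg (not_lt.mpr h1)]

theorem select_spec {w : ℕ → ℝ} {τ : ℝ} {m : ℕ} (hτ : 0 ≤ τ)
    (hτm : τ < ∑ j ∈ Finset.range m, w j) :
    ∃ i < m, ∑ j ∈ Finset.range i, w j ≤ τ ∧ τ < ∑ j ∈ Finset.range (i + 1), w j := by
  induction m with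
  | zero => simp at hτm; linarith
  | succ m ih =>
    by_cases h : τ < ∑ j ∈ Finset.range m, w j
    · obtain ⟨i, hi, h'⟩ := ih h
      exact ⟨i, by omega, h'⟩
    · exact ⟨m, by omega, not_lt.mp h, hτm⟩

/-- Sampling with a uniform multiple of `1 / N` in `[0, 1)` has bias at most `m / N`. -/
theorem abs_sum_select_sub_le {w : ℕ → ℝ} (hw : ∀ j, 0 ≤ w j) {m : ℕ} {W : ℝ}
    (hW : ∑ j ∈ Finset.range m, w j = W) (hW0 : 0 < W) {N : ℕ} (hN : 0 < N) (f : ℕ → ℝ)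
    (hf : ∀ i, |f i| ≤ 1) :
    |∑ r ∈ Finset.range N, f (select w (r / N * W) m)
        - N * ((∑ i ∈ Finset.range m, w i * f i) / W)| ≤ m := by
  have hN' : (0 : ℝ) < N := by exact_mod_cast hN
  set P : ℕ → ℝ := fun i => ∑ j ∈ Finset.range i, w j with hP
  have hPmono : Monotone P := fun i j hij => Finset.sum_le_sum_of_subset_of_nonneg
    (Finset.range_mono hij) fun j _ _ => hw j
  have hP0 : ∀ i, 0 ≤ P i := fun i => Finset.sum_nonneg fun j _ => hw j
  set A : ℕ → ℝ := fun i => N * (P i / W) with hA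
  have hA0 : ∀ i, 0 ≤ A i := fun i => mul_nonneg hN'.le (div_nonneg (hP0 i) hW0.le)
  have hAmono : Monotone A := fun i j hij =>
    mul_le_mul_of_nonneg_left (div_le_div_of_nonneg_right (hPmono hij) hW0.le) hN'.le
  have hle : ∀ (i r : ℕ), P i ≤ r / N * W ↔ ⌈A i⌉₊ ≤ r := by
    intro i r
    rw [Nat.ceil_le, hA]
    simp only
    rw [← div_le_iff₀ hW0, le_div_iff₀ hN', mul_comm]
  -- The multiples that select `i` form an integer interval between rounded-up endpoints, so their
  -- number differs from `N w i / W` by at most one. Summed over `i`, this is the bias `m`.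
  have hfib : ∀ i ∈ Finset.range m,
      (Finset.range N).filter (fun r : ℕ => select w (r / N * W) m = i)
        = Finset.Ico ⌈A i⌉₊ ⌈A (i + 1)⌉₊ := by
    intro i hi
    rw [Finset.mem_range] at hi
    ext r
    rw [Finset.mem_filter, Finset.mem_Ico, Finset.mem_range, ← hle,
      show r < ⌈A (i + 1)⌉₊ ↔ r / N * W < P (i + 1) by rw [← not_le, ← hle, not_le]]
    constructor
    · rintro ⟨hr, hsel⟩
      have hr' : (r : ℝ) < N := by exact_mod_cast hr
      obtain ⟨i', hi', h1, h2⟩ := select_spec (w := w) (m := m) (τ := r / N * W) (by positivity) (by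
        rw [hW, div_mul_eq_mul_div, div_lt_iff₀ hN', mul_comm]
        exact mul_lt_mul_of_pos_left hr' hW0)
      rw [select_eq hw hi' h1 h2] at hsel
      subst hsel
      exact ⟨h1, h2⟩
    · rintro ⟨h1, h2⟩
      refine ⟨?_, select_eq hw hi h1 h2⟩
      have h3 := h2.trans_le ((hPmono (by omega : i + 1 ≤ m)).trans hW.le)
      rw [div_mul_eq_mul_div, div_lt_iff₀ hN', mul_comm] at h3
      exact_mod_cast lt_of_mul_lt_mul_left h3 hW0.le
  have hm : 0 < m := by
    rcases m.eq_zero_or_pos with rfl | h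
    · simp at hW; linarith
    · exact h
  have h1 : ∑ r ∈ Finset.range N, f (select w (r / N * W) m)
      = ∑ i ∈ Finset.range m, ((⌈A (i + 1)⌉₊ : ℝ) - ⌈A i⌉₊) * f i := by
    rw [← Finset.sum_fiberwise_of_maps_to (t := Finset.range m)
      (g := fun r : ℕ => select w (r / N * W) m)
      fun r _ => Finset.mem_range.mpr (select_lt _ _ hm)]
    refine Finset.sum_congr rfl fun i hi => ?_
    rw [Finset.sum_congr rfl (g := fun _ => f i)
      fun r hr => by rw [(Finset.mem_filter.mp hr).2], Finset.sum_const, hfib i hi,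
      Nat.card_Ico, nsmul_eq_mul, Nat.cast_sub (Nat.ceil_mono (hAmono (Nat.le_succ i)))]
  rw [h1, Finset.sum_div, Finset.mul_sum, ← Finset.sum_sub_distrib]
  refine (Finset.abs_sum_le_sum_abs _ _).trans ?_
  calc _ ≤ ∑ i ∈ Finset.range m, (1 : ℝ) := by
        refine Finset.sum_le_sum fun i _ => ?_
        have h2 : A (i + 1) - A i = N * (w i / W) := by
          simp only [hA, hP, Finset.sum_range_succ]
          ring
        have h3 : ((⌈A (i + 1)⌉₊ : ℝ) - ⌈A i⌉₊) * f i - N * (w i * f i / W)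
            = ((⌈A (i + 1)⌉₊ : ℝ) - ⌈A i⌉₊ - (A (i + 1) - A i)) * f i := by
          rw [h2]; ring
        rw [h3, abs_mul]
        refine mul_le_one₀ ?_ (abs_nonneg _) (hf i)
        rw [abs_le]
        constructor <;> linarith [Nat.le_ceil (A i), Nat.le_ceil (A (i + 1)),
          Nat.ceil_lt_add_one (hA0 i), Nat.ceil_lt_add_one (hA0 (i + 1))]
    _ = m := by simp

/-! ## Probabilities -/

theorem coinProb_mono {T : ℕ} {p q : (ℕ → Bool) → Prop} (h : ∀ c, p c → q c) :
    coinProb T p ≤ coinProb T q := by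
  classical
  unfold coinProb
  refine div_le_div_of_nonneg_right (Nat.cast_le.mpr (Finset.card_le_card fun r hr => ?_))
    (by positivity)
  simp only [Finset.mem_filter, Finset.mem_univ, true_and] at hr ⊢
  exact h _ hr

theorem coinProb_of_forall {T : ℕ} {p : (ℕ → Bool) → Prop} (h : ∀ c, p c) : coinProb T p = 1 := by
  simp [coinProb, h]

open Classical in
theorem coinProb_coinBlock {k b T : ℕ} (h : k * b ≤ T) (p : (Fin k → Fin b → Bool) → Prop) :
    coinProb T (fun coins => p fun j => coinBlock b coins j)
      = ((Finset.univ.filter p).card : ℝ) / 2 ^ (k * b) := by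
  rw [coinProb, div_eq_div_iff (by positivity) (by positivity)]
  exact_mod_cast card_coinBlock k b T h p

/-- The index below `m` that the `j`-th block of `b` coins selects. -/
def sample (w : ℕ → ℝ) (m b : ℕ) (coins : ℕ → Bool) (j : ℕ) : ℕ :=
  select w (bitVal (fun l => coins (j * b + l)) b * ∑ i ∈ Finset.range m, w i) m

/-- Two-sided Chernoff bound for each `x`, then a union bound over `X`. The deviations are taken
from the exact weighted mean; `hb` keeps the bias of a sample below `t / 4`. -/
theorem coinProb_sample_ge {X : Type*} [Fintype X] {w : ℕ → ℝ} (hw : ∀ j, 0 ≤ w j) {m b k T : ℕ}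
    {W t : ℝ} (hW : ∑ j ∈ Finset.range m, w j = W) (hW0 : 0 < W) (ht : 0 ≤ t) (ht1 : t ≤ 1)
    (hb : (m : ℝ) ≤ t / 4 * 2 ^ b) (hT : k * b ≤ T) (f : X → ℕ → ℝ) (hf : ∀ x i, |f x i| ≤ 1) :
    1 - 2 * Fintype.card X * Real.exp (-(k * t ^ 2 / 32)) ≤
      coinProb T fun coins => ∀ x, |∑ j ∈ Finset.range k, f x (sample w m b coins j)
        - k * ((∑ i ∈ Finset.range m, w i * f x i) / W)| ≤ k * t := by
  classical
  set μ : X → ℝ := fun x => (∑ i ∈ Finset.range m, w i * f x i) / W with hμ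
  have hμ1 : ∀ x, |μ x| ≤ 1 := by
    intro x
    rw [hμ, abs_div, abs_of_pos hW0, div_le_one hW0, ← hW]
    refine (Finset.abs_sum_le_sum_abs _ _).trans (Finset.sum_le_sum fun i _ => ?_)
    rw [abs_mul, abs_of_nonneg (hw i)]
    exact mul_le_of_le_one_right (hw i) (hf x i)
  set F : X → (Fin b → Bool) → ℝ := fun x c =>
    f x (select w (bitVal (extendCoins c) b * W) m) - μ x with hF
  have hF2 : ∀ x c, |F x c| ≤ 2 := fun x c =>
    (abs_sub _ _).trans (by linarith [hf x (select w (bitVal (extendCoins c) b * W) m), hμ1 x])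
  have hmean : ∀ x, |∑ c, F x c| ≤ t / 4 * Fintype.card (Fin b → Bool) := by
    intro x
    have h1 := abs_sum_select_sub_le hw hW hW0 (N := 2 ^ b) (by positivity) (f x) (hf x)
    push_cast at h1
    rw [← sum_bitVal b fun y => f x (select w (y * W) m)] at h1
    have h2 : ∑ c, F x c = ∑ c : Fin b → Bool, f x (select w (bitVal (extendCoins c) b * W) m)
        - 2 ^ b * μ x := by
      simp [hF, Finset.sum_sub_distrib]
    rw [h2]
    refine (h1.trans hb).trans (le_of_eq ?_)
    simp
  have htail : ∀ x, ((Finset.univ.filter fun ω : Fin k → Fin b → Bool =>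
      ¬ |∑ j, F x (ω j)| ≤ k * t).card : ℝ)
        ≤ 2 * (2 ^ (k * b) * Real.exp (-(k * t ^ 2 / 32))) := by
    intro x
    have h1 := card_sum_ge_le (F x) (hF2 x) ht ht1 ((abs_le.mp (hmean x)).2) k
    have h2 := card_sum_ge_le (fun c => -F x c) (fun c => by rw [abs_neg]; exact hF2 x c) ht ht1
      (by rw [Finset.sum_neg_distrib]; linarith [(abs_le.mp (hmean x)).1]) k
    have h3 : (Finset.univ.filter fun ω : Fin k → Fin b → Bool => ¬ |∑ j, F x (ω j)| ≤ k * t)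
        ⊆ (Finset.univ.filter fun ω : Fin k → Fin b → Bool => k * t ≤ ∑ j, F x (ω j))
          ∪ Finset.univ.filter fun ω : Fin k → Fin b → Bool => k * t ≤ ∑ j, -F x (ω j) := by
      intro ω hω
      simp only [Finset.mem_union, Finset.mem_filter, Finset.mem_univ, true_and, not_le,
        Finset.sum_neg_distrib] at hω ⊢
      rcases lt_abs.mp hω with h | h
      · exact Or.inl h.le
      · exact Or.inr h.le
    have h4 := (Nat.cast_le (α := ℝ)).mpr
      ((Finset.card_le_card h3).trans (Finset.card_union_le _ _))
    have h5 : (Fintype.card (Fin b → Bool) : ℝ) ^ k = 2 ^ (k * b) := by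
      simp [← pow_mul, mul_comm]
    rw [h5] at h1 h2
    push_cast at h4
    linarith
  have hcoin : (fun coins : ℕ → Bool => ∀ x, |∑ j ∈ Finset.range k, f x (sample w m b coins j)
        - k * μ x| ≤ k * t)
      = fun coins => (fun ω : Fin k → Fin b → Bool => ∀ x, |∑ j, F x (ω j)| ≤ k * t)
          fun j => coinBlock b coins j := by
    funext coins
    have h1 : ∀ j, bitVal (extendCoins (coinBlock b coins j)) b
        = bitVal (fun l => coins (j * b + l)) b := fun j =>
      bitVal_congr fun i hi => by simp [extendCoins, coinBlock, hi]
    simp only [hF, h1, Finset.sum_sub_distrib, Finset.sum_const, Finset.card_univ,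
      Fintype.card_fin, nsmul_eq_mul, sample, hW]
    simp only [Finset.sum_range]
  have hprob : coinProb T (fun coins => (fun ω : Fin k → Fin b → Bool =>
      ∀ x, |∑ j, F x (ω j)| ≤ k * t) fun j => coinBlock b coins j)
        = ((Finset.univ.filter fun ω : Fin k → Fin b → Bool =>
          ∀ x, |∑ j, F x (ω j)| ≤ k * t).card : ℝ) / 2 ^ (k * b) := by
    convert coinProb_coinBlock hT fun ω : Fin k → Fin b → Bool =>
      ∀ x, |∑ j, F x (ω j)| ≤ k * t
  rw [hcoin, hprob, le_div_iff₀ (by positivity)]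
  have hsplit := Finset.card_filter_add_card_filter_not (s := Finset.univ)
    fun ω : Fin k → Fin b → Bool => ∀ x, |∑ j, F x (ω j)| ≤ k * t
  have hbad : ((Finset.univ.filter fun ω : Fin k → Fin b → Bool =>
      ¬ ∀ x, |∑ j, F x (ω j)| ≤ k * t).card : ℝ)
        ≤ Fintype.card X * (2 * (2 ^ (k * b) * Real.exp (-(k * t ^ 2 / 32)))) := by
    have h1 : (Finset.univ.filter fun ω : Fin k → Fin b → Bool =>
        ¬ ∀ x, |∑ j, F x (ω j)| ≤ k * t) ⊆ Finset.univ.biUnion fun x =>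
          Finset.univ.filter fun ω : Fin k → Fin b → Bool => ¬ |∑ j, F x (ω j)| ≤ k * t := by
      intro ω hω
      simpa using hω
    calc _ ≤ ∑ x, ((Finset.univ.filter fun ω : Fin k → Fin b → Bool =>
          ¬ |∑ j, F x (ω j)| ≤ k * t).card : ℝ) := by
          exact_mod_cast (Finset.card_le_card h1).trans Finset.card_biUnion_le
      _ ≤ ∑ _x : X, 2 * (2 ^ (k * b) * Real.exp (-(k * t ^ 2 / 32))) :=
          Finset.sum_le_sum fun x _ => htail x
      _ = _ := by simp
  have hcard : (Finset.univ : Finset (Fin k → Fin b → Bool)).card = 2 ^ (k * b) := by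
    simp [← pow_mul, mul_comm]
  rw [hcard] at hsplit
  have hsplit' : ((Finset.univ.filter fun ω : Fin k → Fin b → Bool =>
      ∀ x, |∑ j, F x (ω j)| ≤ k * t).card : ℝ) + (Finset.univ.filter fun ω : Fin k → Fin b → Bool =>
      ¬ ∀ x, |∑ j, F x (ω j)| ≤ k * t).card = 2 ^ (k * b) := by exact_mod_cast hsplit
  linarith

/-! ## Total correctness -/

/-- Started in `s`, the program `P` halts within `B` steps in a store that satisfies `Q`. -/
def Reaches (P : Program) (s : Store) (B : ℕ) (Q : Store → Prop) : Prop :=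
  ∃ (t : ℕ) (s' : Store), t ≤ B ∧ Runs P s t s' ∧ Q s'

theorem Reaches.mono {P : Program} {s : Store} {B B' : ℕ} {Q Q' : Store → Prop}
    (h : Reaches P s B Q) (hB : B ≤ B') (hQ : ∀ s', Q s' → Q' s') : Reaches P s B' Q' := by
  obtain ⟨t, s', ht, hr, hq⟩ := h
  exact ⟨t, s', ht.trans hB, hr, hQ s' hq⟩

theorem Reaches.seq {P P' : Program} {s : Store} {B B' : ℕ} {Q R : Store → Prop}
    (h : Reaches P s B Q) (h' : ∀ s', Q s' → Reaches P' s' B' R) :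
    Reaches (.seq P P') s (B + B') R := by
  obtain ⟨t, s', ht, hr, hq⟩ := h
  obtain ⟨t', s'', ht', hr', hq'⟩ := h' s' hq
  exact ⟨t + t', s'', by omega, .seq hr hr', hq'⟩

theorem Reaches.cond {b : Test} {P P' : Program} {s : Store} {B : ℕ} {Q : Store → Prop}
    (h : b.Holds s → Reaches P s B Q) (h' : ¬ b.Holds s → Reaches P' s B Q) :
    Reaches (.cond b P P') s (1 + B) Q := by
  by_cases hb : b.Holds s
  · obtain ⟨t, s', ht, hr, hq⟩ := h hb
    exact ⟨1 + t, s', by omega, .cond_true hb hr, hq⟩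
  · obtain ⟨t, s', ht, hr, hq⟩ := h' hb
    exact ⟨1 + t, s', by omega, .cond_false hb hr, hq⟩

/-- The invariant is indexed by the number of completed rounds and fixes the number of rounds at
`N`; each costs one test beyond its body, and one final test fails. -/
theorem Reaches.loop {b : Test} {P : Program} {B N : ℕ} (I : ℕ → Store → Prop)
    (hstep : ∀ i < N, ∀ s, I i s → b.Holds s ∧ Reaches P s B (I (i + 1)))
    (hend : ∀ s, I N s → ¬ b.Holds s) {s : Store} (h0 : I 0 s) :
    Reaches (.loop b P) s (N * (B + 1) + 1) (I N) := by
  have key : ∀ d i, i + d = N → ∀ s, I i s → Reaches (.loop b P) s (d * (B + 1) + 1) (I N) := by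
    intro d
    induction d with
    | zero =>
      rintro i rfl s hs
      exact ⟨1, s, by omega, .loop_done (hend s hs), hs⟩
    | succ d ih =>
      intro i hi s hs
      obtain ⟨hb, t, s', ht, hr, hs'⟩ := hstep i (by omega) s hs
      obtain ⟨t', s'', ht', hr', hs''⟩ := ih (i + 1) (by omega) s' hs'
      exact ⟨1 + t + t', s'', by rw [Nat.succ_mul]; omega, .loop_step hb hr hr', hs''⟩
  exact key N 0 (by omega) s h0

/-- A nonempty list of instructions as a program. -/
def block : Instr → List Instr → Program
  | i, [] => .instr i
  | i, j :: l => .seq (.instr i) (block j l)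

theorem Reaches.block {i : Instr} {l : List Instr} {s : Store} {Q : Store → Prop}
    (h : Q (l.foldl (fun s i => i.apply s) (i.apply s))) :
    Reaches (block i l) s (l.length + 1) Q := by
  induction l generalizing i s with
  | nil => exact ⟨1, _, le_rfl, .instr i s, h⟩
  | cons j l ih =>
    obtain ⟨t, s', ht, hr, hq⟩ := ih h
    exact ⟨1 + t, s', by simp only [List.length_cons]; omega, .seq (.instr i s) hr, hq⟩

/-! ## The program -/

/-- Select every edge, with its own weight. -/
def copyProgram : Program :=
  .loop (.ilt 2 1) (block (.rload 6 0 2) [.rstore 1 2 6, .istore 2 2 3, .iadd 2 2 3])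

/-- Sum the weights in real register `7`. -/
def totalProgram : Program :=
  .loop (.ilt 2 1) (block (.rload 6 0 2) [.radd 7 7 6, .iadd 2 2 3])

/-- Read `2 m` coins as a binary fraction, in real register `9`. -/
def drawProgram : Program :=
  .loop (.ilt 2 6) (block (.flip 7) [.rofnat 10 7, .radd 9 9 10, .rmul 9 9 1, .iadd 2 2 3])

/-- Find the last prefix sum that is at most real register `9`; its index is put in integer
register `4`. -/
def scanProgram : Program :=
  .loop (.ilt 2 1)
    (.seq (.cond (.rlt 9 10) (block (.iconst 8 0) []) (block (.iadd 4 2 8) []))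
      (block (.rload 6 0 2) [.radd 10 10 6, .iadd 2 2 3]))

/-- Select a random edge and increase its weight by one. (The defining property of a
sparsification does not change when all its weights are scaled.) -/
def sampleProgram : Program :=
  .seq (block (.iconst 2 0) [.rconst 9 0])
    (.seq drawProgram
      (.seq (block (.rmul 9 9 7) [.iconst 2 0, .rconst 10 0, .iconst 4 0])
        (.seq scanProgram
          (block (.istore 2 4 3)
            [.rload 6 1 4, .rofnat 11 3, .radd 6 6 11, .rstore 1 4 6, .radd 8 8 4]))))

/-- The sparsification program. -/
def sparsifyProgram : Program :=
  .seq (block (.rconst 1 (1 / 2)) [.iconst 3 1])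
    (.cond (.rlt 0 1)
      (.seq (block (.rofnat 2 0) [.rconst 3 4096, .rmul 2 3 2, .rmul 4 0 0, .rofnat 5 1,
          .rmul 5 5 4, .iadd 6 1 1])
        (.cond (.rlt 2 5)
          (.seq totalProgram (.loop (.rlt 8 2) sampleProgram))
          copyProgram))
      (block (.iconst 3 1) []))

/-! ### Invariants and running times of the program pieces -/

theorem reaches_copyProgram {m : ℕ} {w : ℕ → ℝ} {s : Store} (h1 : s.ireg 1 = m)
    (h2 : s.ireg 2 = 0) (h3 : s.ireg 3 = 1) (hw : s.rmem 0 = w) :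
    Reaches copyProgram s (m * 5 + 1) fun s' =>
      ∀ i < m, s'.imem 2 i = 1 ∧ s'.rmem 1 i = w i := by
  refine (Reaches.loop (B := 4) (N := m) (fun i s => s.ireg 1 = m ∧ s.ireg 2 = i ∧ s.ireg 3 = 1 ∧
    s.rmem 0 = w ∧ ∀ j < i, s.imem 2 j = 1 ∧ s.rmem 1 j = w j) ?_ ?_
    ⟨h1, h2, h3, hw, by simp⟩).mono le_rfl fun s' h => h.2.2.2.2
  · rintro i hi s ⟨h1, h2, h3, hw, h⟩
    refine ⟨by simp [Test.Holds, h1, h2, hi], Reaches.block ?_⟩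
    refine ⟨by simpa [Instr.apply] using h1, by simp [Instr.apply, h2, h3],
      by simpa [Instr.apply] using h3, by simpa [Instr.apply] using hw, ?_⟩
    · intro j hj
      rcases Nat.lt_succ_iff_lt_or_eq.mp hj with hj' | rfl
      · simp [Instr.apply, h2, hj'.ne, h j hj']
      · simp [Instr.apply, h2, h3, hw]
  · rintro s ⟨h1, h2, -⟩
    simp [Test.Holds, h1, h2]

/-- The store while edges are sampled: `W` is the sum of weights so far, `K` the target for the
progress `x`, which grows by `e` with each sample, and `cnt i` is how often `i` was selected. -/
structure Sampling (m : ℕ) (w : ℕ → ℝ) (W K e : ℝ) (coins : ℕ → Bool) (cnt : ℕ → ℕ) (x : ℝ)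
    (s : Store) : Prop where
  coins : s.coins = coins
  ireg1 : s.ireg 1 = m
  ireg3 : s.ireg 3 = 1
  ireg6 : s.ireg 6 = 2 * m
  ireg8 : s.ireg 8 = 0
  rreg1 : s.rreg 1 = 1 / 2
  rreg2 : s.rreg 2 = K
  rreg4 : s.rreg 4 = e
  rreg7 : s.rreg 7 = W
  rreg8 : s.rreg 8 = x
  rmem0 : s.rmem 0 = w
  rmem1 : s.rmem 1 = fun i => (cnt i : ℝ)
  imem2 : s.imem 2 = fun i => if cnt i = 0 then 0 else 1

section
variable {m : ℕ} {w : ℕ → ℝ} {W K e : ℝ} {coins : ℕ → Bool} {cnt : ℕ → ℕ} {x : ℝ} {s : Store}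

theorem reaches_totalProgram (h : Sampling m w 0 K e coins cnt x s) {u : ℕ} (hu : s.used = u)
    (h2 : s.ireg 2 = 0) :
    Reaches totalProgram s (m * 4 + 1) fun s' =>
      Sampling m w (∑ i ∈ Finset.range m, w i) K e coins cnt x s' ∧ s'.used = u := by
  refine (Reaches.loop (B := 3) (N := m) (fun i s =>
    Sampling m w (∑ i ∈ Finset.range i, w i) K e coins cnt x s ∧ s.used = u ∧ s.ireg 2 = i) ?_ ?_
    ⟨by simpa using h, hu, h2⟩).mono le_rfl fun s' h => ⟨h.1, h.2.1⟩
  · rintro i hi s ⟨h, hu, h2⟩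
    refine ⟨by simp [Test.Holds, h.ireg1, h2, hi], Reaches.block ⟨?_, ?_, ?_⟩⟩
    · constructor <;> simp [Instr.apply, h.coins, h.ireg1, h.ireg3, h.ireg6, h.ireg8, h.rreg1,
        h.rreg2, h.rreg4, h.rreg7, h.rreg8, h.rmem0, h.rmem1, h.imem2, h2, Finset.sum_range_succ]
    · simp [Instr.apply, hu]
    · simp [Instr.apply, h2, h.ireg3]
  · rintro s ⟨h, -, h2⟩
    simp [Test.Holds, h.ireg1, h2]

theorem reaches_drawProgram (h : Sampling m w W K e coins cnt x s) {u : ℕ} (hu : s.used = u)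
    (h2 : s.ireg 2 = 0) (h9 : s.rreg 9 = 0) :
    Reaches drawProgram s (2 * m * 6 + 1) fun s' =>
      Sampling m w W K e coins cnt x s' ∧ s'.used = u + 2 * m ∧
        s'.rreg 9 = bitVal (fun l => coins (u + l)) (2 * m) := by
  refine (Reaches.loop (B := 5) (N := 2 * m) (fun i s =>
    Sampling m w W K e coins cnt x s ∧ s.used = u + i ∧ s.ireg 2 = i ∧
      s.rreg 9 = bitVal (fun l => coins (u + l)) i) ?_ ?_
    ⟨h, hu, h2, h9⟩).mono le_rfl fun s' h => ⟨h.1, h.2.1, h.2.2.2⟩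
  · rintro i hi s ⟨h, hu, h2, h9⟩
    refine ⟨by simp [Test.Holds, h.ireg6, h2, hi], Reaches.block ⟨?_, ?_, ?_, ?_⟩⟩
    · constructor <;> simp [Instr.apply, h.coins, h.ireg1, h.ireg3, h.ireg6, h.ireg8, h.rreg1,
        h.rreg2, h.rreg4, h.rreg7, h.rreg8, h.rmem0, h.rmem1, h.imem2]
    · simp [Instr.apply, hu, add_assoc]
    · simp [Instr.apply, h2, h.ireg3]
    · simp [Instr.apply, h9, h.rreg1, h.coins, hu, bitVal]
  · rintro s ⟨h, -, h2, -⟩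
    simp [Test.Holds, h.ireg6, h2]

theorem reaches_scanProgram (h : Sampling m w W K e coins cnt x s) {u : ℕ} (hu : s.used = u)
    (h2 : s.ireg 2 = 0) (h4 : s.ireg 4 = 0) {τ : ℝ} (h9 : s.rreg 9 = τ) (h10 : s.rreg 10 = 0) :
    Reaches scanProgram s (m * 6 + 1) fun s' =>
      Sampling m w W K e coins cnt x s' ∧ s'.used = u ∧ s'.ireg 4 = select w τ m := by
  refine (Reaches.loop (B := 5) (N := m) (fun i s =>
    Sampling m w W K e coins cnt x s ∧ s.used = u ∧ s.ireg 2 = i ∧ s.ireg 4 = select w τ i ∧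
      s.rreg 9 = τ ∧ s.rreg 10 = ∑ j ∈ Finset.range i, w j) ?_ ?_
    ⟨h, hu, h2, h4, h9, by simpa using h10⟩).mono le_rfl fun s' h => ⟨h.1, h.2.1, h.2.2.2.1⟩
  · rintro i hi s ⟨h, hu, h2, h4, h9, h10⟩
    refine ⟨by simp [Test.Holds, h.ireg1, h2, hi], Reaches.seq (B := 1 + 1) (B' := 3)
      (Q := fun s => Sampling m w W K e coins cnt x s ∧ s.used = u ∧ s.ireg 2 = i ∧
        s.ireg 4 = select w τ (i + 1) ∧ s.rreg 9 = τ ∧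
        s.rreg 10 = ∑ j ∈ Finset.range i, w j) ?_ ?_⟩
    · refine Reaches.cond (fun hc => Reaches.block ?_) (fun hc => Reaches.block ?_)
      all_goals
        simp only [Test.Holds, h9, h10] at hc
        refine ⟨?_, by simp [Instr.apply, hu], by simp [Instr.apply, h2],
          by simp [Instr.apply, select, hc, h4, h2, h.ireg8], by simp [Instr.apply, h9],
          by simp [Instr.apply, h10]⟩
        constructor <;> simp [Instr.apply, h.coins, h.ireg1, h.ireg3, h.ireg6, h.ireg8, h.rreg1,
          h.rreg2, h.rreg4, h.rreg7, h.rreg8, h.rmem0, h.rmem1, h.imem2]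
    · rintro s ⟨h, hu, h2, h4, h9, h10⟩
      refine Reaches.block ⟨?_, by simp [Instr.apply, hu], by simp [Instr.apply, h2, h.ireg3],
        by simp [Instr.apply, h4], by simp [Instr.apply, h9],
        by simp [Instr.apply, h10, h.rmem0, h2, Finset.sum_range_succ]⟩
      constructor <;> simp [Instr.apply, h.coins, h.ireg1, h.ireg3, h.ireg6, h.ireg8, h.rreg1,
        h.rreg2, h.rreg4, h.rreg7, h.rreg8, h.rmem0, h.rmem1, h.imem2]
  · rintro s ⟨h, -, h2, -⟩
    simp [Test.Holds, h.ireg1, h2]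

theorem reaches_sampleProgram (h : Sampling m w W K e coins cnt x s) {u : ℕ} (hu : s.used = u) :
    Reaches sampleProgram s (18 * m + 14) fun s' =>
      Sampling m w W K e coins
        (fun i => cnt i + if i = select w (bitVal (fun l => coins (u + l)) (2 * m) * W) m
          then 1 else 0) (x + e) s' ∧ s'.used = u + 2 * m := by
  refine Reaches.mono (B := 2 + ((2 * m * 6 + 1) + (4 + ((m * 6 + 1) + 6)))) (Reaches.seq
    (Q := fun s => Sampling m w W K e coins cnt x s ∧ s.used = u ∧ s.ireg 2 = 0 ∧ s.rreg 9 = 0)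
    (Reaches.block ⟨?_, ?_⟩) ?_) (by omega) fun _ h => h
  · constructor <;> simp [Instr.apply, h.coins, h.ireg1, h.ireg3, h.ireg6, h.ireg8, h.rreg1,
      h.rreg2, h.rreg4, h.rreg7, h.rreg8, h.rmem0, h.rmem1, h.imem2]
  · simp [Instr.apply, hu]
  rintro s ⟨h, hu, h2, h9⟩
  refine (reaches_drawProgram h hu h2 h9).seq ?_
  rintro s ⟨h, hu, h9⟩
  set τ := bitVal (fun l => coins (u + l)) (2 * m) * W with hτ
  refine Reaches.seq (Q := fun s => Sampling m w W K e coins cnt x s ∧ s.used = u + 2 * m ∧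
    s.ireg 2 = 0 ∧ s.ireg 4 = 0 ∧ s.rreg 9 = τ ∧ s.rreg 10 = 0) (Reaches.block ⟨?_, ?_⟩) ?_
  · constructor <;> simp [Instr.apply, h.coins, h.ireg1, h.ireg3, h.ireg6, h.ireg8, h.rreg1,
      h.rreg2, h.rreg4, h.rreg7, h.rreg8, h.rmem0, h.rmem1, h.imem2]
  · simp [Instr.apply, hu, h9, h.rreg7, hτ]
  rintro s ⟨h, hu, h2, h4, h9, h10⟩
  refine (reaches_scanProgram h hu h2 h4 h9 h10).seq ?_
  rintro s ⟨h, hu, h4⟩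
  refine Reaches.block ⟨?_, by simp [Instr.apply, hu]⟩
  constructor
  case rmem1 =>
    funext i
    by_cases hi : i = select w τ m
    · simp [Instr.apply, h.rmem1, h4, h.ireg3, hi]
    · simp [Instr.apply, h.rmem1, h4, h.ireg3, hi]
  case imem2 =>
    funext i
    by_cases hi : i = select w τ m
    · simp [Instr.apply, h.imem2, h4, h.ireg3, hi]
    · simp [Instr.apply, h.imem2, h4, h.ireg3, hi]
  all_goals simp [Instr.apply, h.coins, h.ireg1, h.ireg3, h.ireg6, h.ireg8, h.rreg1,
    h.rreg2, h.rreg4, h.rreg7, h.rreg8, h.rmem0]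

end

/-- How often the index `i` is among the first `k` samples. -/
def sampleCount (w : ℕ → ℝ) (m b : ℕ) (coins : ℕ → Bool) (k i : ℕ) : ℕ :=
  ∑ j ∈ Finset.range k, if i = sample w m b coins j then 1 else 0

/-- What the program outputs in the arrays, with `k` samples if it takes samples. -/
def Output (n m : ℕ) (w : ℕ → ℝ) (ε : ℝ) (coins : ℕ → Bool) (k : ℕ) (s : Store) : Prop :=
  (1 / 2 ≤ ε ∧ ∀ i, s.imem 2 i = 0) ∨
  (m * ε ^ 2 ≤ 4096 * n ∧ ∀ i < m, s.imem 2 i = 1 ∧ s.rmem 1 i = w i) ∨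
  (ε < 1 / 2 ∧ 4096 * n < m * ε ^ 2 ∧
    (∀ i, s.imem 2 i = if sampleCount w m (2 * m) coins k i = 0 then 0 else 1) ∧
    ∀ i, s.rmem 1 i = sampleCount w m (2 * m) coins k i)

/-- The machine has no rounding, so `k` is never computed: the loop adds `ε²` per sample until it
reaches `4096 n`, which takes exactly `⌈4096 n / ε²⌉` rounds. -/
theorem reaches_sparsifyProgram {n m : ℕ} {w : ℕ → ℝ} {ε : ℝ} {coins : ℕ → Bool} {s : Store}
    (hε : 0 < ε) (hi : s.ireg = fun a => if a = 0 then n else if a = 1 then m else 0)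
    (hr : s.rreg = fun a => if a = 0 then ε else 0) (hi2 : s.imem 2 = fun _ => 0)
    (hr1 : s.rmem 1 = fun _ => 0) (hr0 : s.rmem 0 = w) (hc : s.coins = coins)
    (hu : s.used = 0) :
    Reaches sparsifyProgram s (100 * (n + m + 1) ^ 2)
      (Output n m w ε coins ⌈4096 * n / ε ^ 2⌉₊) := by
  have hε2 : 0 < ε ^ 2 := by positivity
  set k := ⌈4096 * n / ε ^ 2⌉₊ with hk
  have hnm : (m + 1) ^ 2 ≤ (n + m + 1) ^ 2 := Nat.pow_le_pow_left (by omega) 2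
  -- Integer register `6` receives `2 m` only in the next block; overriding it in the assertion lets
  -- `Sampling` describe the store already now.
  refine Reaches.mono (B := 2 + (1 + (7 + (1 + ((m * 4 + 1) + (m * (18 * m + 14 + 1) + 1 + m))))))
    (Reaches.seq (Q := fun s => Sampling m w 0 0 0 coins (fun _ => 0) 0 { s with
      ireg := Function.update s.ireg 6 (2 * m) } ∧ s.used = 0 ∧ s.ireg 2 = 0 ∧ s.ireg 0 = n ∧
      s.rreg 0 = ε) (Reaches.block ⟨?_, ?_⟩) ?_) (by nlinarith) fun _ h => h
  · constructor <;> simp [Instr.apply, hi, hr, hi2, hr1, hr0, hc]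
  · simp [Instr.apply, hi, hr, hu]
  rintro s ⟨h, hu, h2, h0, hr0⟩
  obtain ⟨hc, h1, h3, -, h8, hr1, -, -, hr7, hr8, hm0, hm1, hi2⟩ := h
  simp at hc h1 h3 h8 hr1 hr7 hr8 hm0 hm1 hi2
  refine Reaches.cond (fun hlt => ?_) (fun hlt => ?_)
  · have hlt' : ε < 1 / 2 := by simpa [Test.Holds, hr0, hr1] using hlt
    refine Reaches.seq (Q := fun s =>
      Sampling m w 0 (4096 * n) (ε ^ 2) coins (fun _ => 0) 0 s ∧ s.used = 0 ∧ s.ireg 2 = 0 ∧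
        s.rreg 5 = m * ε ^ 2) (Reaches.block ⟨?_, ?_⟩) ?_
    · constructor <;> simp [Instr.apply, hc, h1, h3, h8, hr1, hr7, hr8, hm0, hm1, hi2, h0, hr0,
        sq, two_mul]
    · simp [Instr.apply, hu, h2, h1, hr0, sq]
    rintro s ⟨h, hu, h2, h5⟩
    refine Reaches.cond (fun hs => ?_) (fun hs => ?_)
    · have hs' : 4096 * n < m * ε ^ 2 := by simpa [Test.Holds, h.rreg2, h5] using hs
      -- The branching test caps the number of samples by `m`, so the time does not depend on `ε`.
      have hkm : k ≤ m := by
        rw [hk, Nat.ceil_le, div_le_iff₀ hε2]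
        exact hs'.le
      refine (reaches_totalProgram h hu h2).seq fun s hs => ?_
      refine (Reaches.loop (B := 18 * m + 14) (N := k) (fun j s =>
        Sampling m w (∑ i ∈ Finset.range m, w i) (4096 * n) (ε ^ 2) coins
          (sampleCount w m (2 * m) coins j) (j * ε ^ 2) s ∧ s.used = j * (2 * m)) ?_ ?_
        ⟨by simpa [show sampleCount w m (2 * m) coins 0 = fun _ => 0 from
          funext fun i => by simp [sampleCount]] using hs.1, by simpa using hs.2⟩).mono ?_ ?_
      · rintro j hj s ⟨h, hu⟩
        refine ⟨?_, (reaches_sampleProgram h hu).mono le_rfl ?_⟩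
        · rw [hk, Nat.lt_ceil, lt_div_iff₀ hε2] at hj
          simpa [Test.Holds, h.rreg8, h.rreg2] using hj
        · rintro s ⟨h, hu⟩
          refine ⟨?_, by rw [hu]; ring⟩
          have e1 : sampleCount w m (2 * m) coins (j + 1) = fun i =>
              sampleCount w m (2 * m) coins j i + if i = select w (bitVal (fun l =>
                coins (j * (2 * m) + l)) (2 * m) * ∑ i ∈ Finset.range m, w i) m
              then 1 else 0 := by
            funext i
            rw [sampleCount, Finset.sum_range_succ]
            rfl
          have e2 : ((j + 1 : ℕ) : ℝ) * ε ^ 2 = j * ε ^ 2 + ε ^ 2 := by push_cast; ring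
          rw [e1, e2]
          exact h
      · rintro s ⟨h, -⟩
        have := Nat.le_ceil (4096 * n / ε ^ 2)
        rw [div_le_iff₀ hε2] at this
        simpa [Test.Holds, h.rreg8, h.rreg2] using this
      · nlinarith [Nat.mul_le_mul_right (18 * m + 14 + 1) hkm]
      · rintro s ⟨h, -⟩
        exact Or.inr (Or.inr ⟨hlt', hs', fun i => by rw [h.imem2], fun i => by rw [h.rmem1]⟩)
    · refine (reaches_copyProgram h.ireg1 h2 h.ireg3 h.rmem0).mono (by nlinarith) fun s hs' => ?_
      have : m * ε ^ 2 ≤ 4096 * n := by simpa [Test.Holds, h.rreg2, h5] using hs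
      exact Or.inr (Or.inl ⟨this, hs'⟩)
  · have hlt' : 1 / 2 ≤ ε := by simpa [Test.Holds, hr0, hr1] using hlt
    refine (Reaches.block ?_ : Reaches _ s (0 + 1) _).mono (by omega) fun _ h => h
    exact Or.inl ⟨hlt', fun i => by simp [Instr.apply, hi2]⟩

/-! ## Correctness of the output -/

section
variable {n m : ℕ} {G : SimpleGraph (Fin n)} {w : Sym2 (Fin n) → ℝ}
  {edge : Fin m → Fin n × Fin n} {ε : ℝ} {s : Store}

/-- The weights of the listed edges, continued by `0`. -/
def listedWeight (edge : Fin m → Fin n × Fin n) (w : Sym2 (Fin n) → ℝ) (i : ℕ) : ℝ :=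
  if h : i < m then w s((edge ⟨i, h⟩).1, (edge ⟨i, h⟩).2) else 0

/-- The value of the listed edges on a sign vector, continued by `0`. -/
def listedSign (edge : Fin m → Fin n × Fin n) (x : Fin n → Bool) (i : ℕ) : ℝ :=
  if h : i < m then sgn (x (edge ⟨i, h⟩).1) * sgn (x (edge ⟨i, h⟩).2) else 0

theorem abs_listedSign_le (x : Fin n → Bool) (i : ℕ) : |listedSign edge x i| ≤ 1 := by
  unfold listedSign
  split_ifs with h
  · cases x (edge ⟨i, h⟩).1 <;> cases x (edge ⟨i, h⟩).2 <;> simp [sgn]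
  · simp

theorem ListsEdges.edgeFinset_eq [DecidableRel G.Adj] (he : ListsEdges G edge) :
    G.edgeFinset = Finset.univ.image fun i => s((edge i).1, (edge i).2) := by
  ext e
  rw [SimpleGraph.mem_edgeFinset, ← he.2]
  simp

theorem ListsEdges.ne (he : ListsEdges G edge) (i : Fin m) : (edge i).1 ≠ (edge i).2 := by
  have : s((edge i).1, (edge i).2) ∈ G.edgeSet := he.2 ▸ ⟨i, rfl⟩
  exact G.ne_of_adj this

theorem ListsEdges.card [DecidableRel G.Adj] (he : ListsEdges G edge) : G.edgeFinset.card = m := by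
  rw [he.edgeFinset_eq, Finset.card_image_of_injective _ he.1, Finset.card_univ, Fintype.card_fin]

theorem ListsEdges.outWeights_apply (he : ListsEdges G edge) (i : Fin m) :
    outWeights edge s s((edge i).1, (edge i).2) = s.rmem 1 i := by
  rw [outWeights, Finset.sum_eq_single i]
  · intro j hj hji
    exact absurd (he.1 (Finset.mem_filter.mp hj).2) hji
  · intro h
    simp at h

theorem not_isDiag_of_mem_edgeFinset [DecidableRel G.Adj] : ∀ e ∈ G.edgeFinset, ¬ e.IsDiag := fun _ he =>
  G.not_isDiag_of_mem_edgeFinset he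

theorem sum_sampleCount {lam : ℕ → ℝ} {wt : ℕ → ℝ} {b k : ℕ} {coins : ℕ → Bool} (hm : 0 < m) :
    ∑ i : Fin m, (sampleCount wt m b coins k i : ℝ) * lam i
      = ∑ j ∈ Finset.range k, lam (sample wt m b coins j) := by
  simp only [sampleCount, Nat.cast_sum, Finset.sum_mul]
  rw [Finset.sum_comm]
  refine Finset.sum_congr rfl fun j _ => ?_
  have hlt : sample wt m b coins j < m := select_lt _ _ hm
  rw [Finset.sum_eq_single ⟨_, hlt⟩]
  · simp
  · intro i _ hi
    rw [if_neg fun h => hi (Fin.ext h)]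
    simp
  · simp

/-- The coefficients `(W / k) cnt i - w i` sum to zero, as the counts sum to `k`, so the sign-vector
bound applies with `B = ε W / 6`, and `3 / 2 · B = ε W / 4`. The hypothesis `hgood` is cleared of
denominators so that it also makes sense for `W = 0`. -/
theorem isSparsification_of_sampleCount [DecidableRel G.Adj] (he : ListsEdges G edge)
    (hw : ∀ e ∈ G.edgeFinset, 0 ≤ w e) (hε : 0 < ε) (hε2 : ε < 1 / 2) (hn : 0 < n) (hm : 0 < m)
    {coins : ℕ → Bool} {b k : ℕ} (hk : k = ⌈4096 * n / ε ^ 2⌉₊)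
    (hi : ∀ i, s.imem 2 i =
      if sampleCount (listedWeight edge w) m b coins k i = 0 then 0 else 1)
    (hr : ∀ i, s.rmem 1 i = sampleCount (listedWeight edge w) m b coins k i)
    (hgood : ∀ x : Fin n → Bool,
      |(∑ e ∈ G.edgeFinset, w e) * ∑ j ∈ Finset.range k,
          listedSign edge x (sample (listedWeight edge w) m b coins j)
        - k * ∑ i ∈ Finset.range m, listedWeight edge w i * listedSign edge x i|
        ≤ k * (∑ e ∈ G.edgeFinset, w e) * (ε / 6)) :
    IsSparsification 5000 ε G.edgeFinset w (outEdges edge s) (outWeights edge s) := by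
  set cnt := sampleCount (listedWeight edge w) m b coins k with hcnt
  set W := ∑ e ∈ G.edgeFinset, w e with hW
  have hn' : (1 : ℝ) ≤ n := by exact_mod_cast hn
  have hk0 : (0 : ℝ) < k := by
    rw [hk, Nat.cast_pos, Nat.ceil_pos]
    positivity
  have hW0 : 0 ≤ W := Finset.sum_nonneg hw
  have hsumcnt : ∑ i : Fin m, (cnt i : ℝ) = k := by
    simpa using sum_sampleCount (lam := fun _ => 1) (wt := listedWeight edge w) (b := b) (k := k)
      (coins := coins) hm
  have hsumE : ∀ F : Sym2 (Fin n) → ℝ,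
      ∑ e ∈ G.edgeFinset, F e = ∑ i, F s((edge i).1, (edge i).2) := fun F => by
    rw [he.edgeFinset_eq, Finset.sum_image fun a _ b _ h => he.1 h]
  have hen : ∀ ψ : QubitState n, energy (hamiltonian (outEdges edge s) (outWeights edge s)) ψ
      = ∑ i : Fin m, (cnt i : ℝ) * energy (edgeTerm s((edge i).1, (edge i).2)) ψ := by
    intro ψ
    rw [energy_hamiltonian, outEdges, Finset.sum_image fun a _ b _ h => he.1 h,
      Finset.sum_filter]
    refine Finset.sum_congr rfl fun i _ => ?_
    rw [he.outWeights_apply, hi, hr]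
    by_cases h : cnt i = 0 <;> simp [h]
  refine isSparsification_of_close (lam := W / k) hε (by linarith) (by positivity)
    not_isDiag_of_mem_edgeFinset hw ?_ ?_ ?_ ?_
  · rw [he.edgeFinset_eq]
    exact Finset.image_subset_image (Finset.filter_subset _ _)
  · intro e h
    obtain ⟨i, -, rfl⟩ := Finset.mem_image.mp h
    rw [he.outWeights_apply, hr]
    positivity
  -- Every selected edge has count at least one, so there are at most `k` of them. The increase from
  -- `4096` to `5000` pays for rounding `k` up, because `n / ε² ≥ 1`.
  · have h1 : ((outEdges edge s).card : ℝ) ≤ k := by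
      rw [← hsumcnt]
      refine (Nat.cast_le.mpr Finset.card_image_le).trans ?_
      rw [Finset.card_filter, Nat.cast_sum]
      refine Finset.sum_le_sum fun i _ => ?_
      rw [hi, Nat.cast_le]
      split_ifs <;> omega
    have h2 := Nat.ceil_lt_add_one (a := 4096 * n / ε ^ 2) (by positivity)
    rw [← hk] at h2
    have h3 : 1 ≤ n / ε ^ 2 := by
      rw [le_div_iff₀ (by positivity)]
      nlinarith
    have h4 : 5000 * ε⁻¹ ^ 2 * n = 4096 * n / ε ^ 2 + 904 * (n / ε ^ 2) := by
      field_simp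
      ring
    rw [h4]
    linarith
  · intro ψ hψ
    have h1 := abs_sum_energy_edgeTerm_le edge he.ne
      (fun i => W / k * cnt i - w s((edge i).1, (edge i).2)) ?_ (B := W * (ε / 6)) ?_ hψ
    · rw [hen, energy_hamiltonian, hsumE, Finset.mul_sum, ← Finset.sum_sub_distrib]
      calc _ = _ := by
            congr 1
            exact Finset.sum_congr rfl fun i _ => by ring
        _ ≤ _ := h1
        _ = _ := by ring
    · rw [Finset.sum_sub_distrib, ← Finset.mul_sum, hsumcnt, ← hsumE, ← hW,
        div_mul_cancel₀ _ hk0.ne', sub_self]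
    · intro x
      have h2 : ∑ i : Fin m, (W / k * cnt i - w s((edge i).1, (edge i).2))
          * (sgn (x (edge i).1) * sgn (x (edge i).2))
          = (W * ∑ j ∈ Finset.range k, listedSign edge x (sample (listedWeight edge w) m b coins j)
            - k * ∑ i ∈ Finset.range m, listedWeight edge w i * listedSign edge x i) / k := by
        rw [← sum_sampleCount hm, Finset.sum_range, sub_div, mul_div_right_comm,
          mul_div_cancel_left₀ _ hk0.ne', Finset.mul_sum, ← Finset.sum_sub_distrib]
        refine Finset.sum_congr rfl fun i _ => ?_
        simp only [listedSign, listedWeight, i.isLt, dif_pos, Fin.eta]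
        ring
      rw [h2, abs_div, abs_of_pos hk0, div_le_iff₀ hk0]
      exact (hgood x).trans (le_of_eq (by ring))

theorem isSparsification_of_output [DecidableRel G.Adj] (he : ListsEdges G edge) (hw : ∀ e ∈ G.edgeFinset, 0 ≤ w e)
    (hε : 0 < ε) {coins : ℕ → Bool} {k : ℕ} (hk : k = ⌈4096 * n / ε ^ 2⌉₊)
    (hs : Output n m (listedWeight edge w) ε coins k s)
    (hgood : ε < 1 / 2 → 4096 * n < m * ε ^ 2 → ∀ x : Fin n → Bool,
      |(∑ e ∈ G.edgeFinset, w e) * ∑ j ∈ Finset.range k,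
          listedSign edge x (sample (listedWeight edge w) m (2 * m) coins j)
        - k * ∑ i ∈ Finset.range m, listedWeight edge w i * listedSign edge x i|
        ≤ k * (∑ e ∈ G.edgeFinset, w e) * (ε / 6)) :
    IsSparsification 5000 ε G.edgeFinset w (outEdges edge s) (outWeights edge s) := by
  rcases hs with ⟨hε2, hi⟩ | ⟨hc, hi⟩ | ⟨hε2, hc, hi, hr⟩
  · have : outEdges edge s = ∅ := by simp [outEdges, hi]
    rw [this]
    exact isSparsification_empty (by norm_num) hε2 _ not_isDiag_of_mem_edgeFinset hw
  · have : outEdges edge s = G.edgeFinset := by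
      rw [he.edgeFinset_eq, outEdges, Finset.filter_true_of_mem]
      intro i _
      rw [(hi i i.isLt).1]
      exact one_ne_zero
    rw [this]
    refine isSparsification_self hε not_isDiag_of_mem_edgeFinset hw ?_ ?_
    · intro e h
      rw [he.edgeFinset_eq] at h
      obtain ⟨i, -, rfl⟩ := Finset.mem_image.mp h
      rw [he.outWeights_apply, (hi i i.isLt).2]
      simp [listedWeight]
    · rw [he.card]
      rw [← le_div_iff₀ (by positivity)] at hc
      refine hc.trans ?_
      rw [inv_pow, mul_right_comm, ← div_eq_mul_inv]
      gcongr
      norm_num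
  · have hm : 0 < m := by
      rcases m.eq_zero_or_pos with rfl | h
      · have : (0 : ℝ) ≤ 4096 * n := by positivity
        simp at hc
        linarith
      · exact h
    exact isSparsification_of_sampleCount he hw hε hε2 (edge ⟨0, hm⟩).1.pos hm hk hi hr
      (hgood hε2 hc)

theorem two_mul_two_pow_mul_exp_le {n : ℕ} (hn : 0 < n) {y : ℝ} (hy : 3 * n ≤ y) :
    2 * (2 : ℝ) ^ n * Real.exp (-y) ≤ (1 / 2) ^ n := by
  have h1 : (8 : ℝ) ^ n ≤ Real.exp y := by
    have h2 : (2 : ℝ) ≤ Real.exp 1 := by linarith [Real.add_one_le_exp (1 : ℝ)]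
    calc (8 : ℝ) ^ n = 2 ^ (3 * n) := by rw [pow_mul]; norm_num
      _ ≤ Real.exp 1 ^ (3 * n) := by gcongr
      _ = Real.exp (3 * n) := by rw [← Real.exp_nat_mul]; push_cast; ring_nf
      _ ≤ Real.exp y := Real.exp_le_exp.mpr hy
  have h3 : (2 : ℝ) ≤ 2 ^ n := by
    calc (2 : ℝ) = 2 ^ 1 := by norm_num
      _ ≤ 2 ^ n := pow_le_pow_right₀ (by norm_num) hn
  rw [Real.exp_neg, ← div_eq_mul_inv, div_le_iff₀ (Real.exp_pos _)]
  calc 2 * (2 : ℝ) ^ n ≤ 2 ^ n * 2 ^ n := by gcongr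
    _ = (1 / 2) ^ n * 8 ^ n := by rw [← mul_pow, ← mul_pow]; norm_num
    _ ≤ _ := by gcongr

theorem reaches_output (edge : Fin m → Fin n × Fin n) (w : Sym2 (Fin n) → ℝ) (hε : 0 < ε)
    (coins : ℕ → Bool) :
    Reaches sparsifyProgram (initStore edge w ε coins) (100 * (n + m + 1) ^ 2)
      (Output n m (listedWeight edge w) ε coins ⌈4096 * n / ε ^ 2⌉₊) :=
  reaches_sparsifyProgram hε rfl rfl (by simp [initStore]) (by simp [initStore])
    (by funext i; simp [initStore, listedWeight]) rfl rfl

theorem le_coinProb_isSparsification [DecidableRel G.Adj] (he : ListsEdges G edge)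
    (hw : ∀ e ∈ G.edgeFinset, 0 ≤ w e) (hε : 0 < ε) :
    1 - (1 / 2 : ℝ) ^ n ≤ coinProb (100 * (n + m + 1) ^ 2) fun coins =>
      ∃ (t : ℕ) (s : Store), Runs sparsifyProgram (initStore edge w ε coins) t s ∧
        IsSparsification 5000 ε G.edgeFinset w (outEdges edge s) (outWeights edge s) := by
  set k := ⌈4096 * n / ε ^ 2⌉₊ with hk
  set W := ∑ e ∈ G.edgeFinset, w e with hW
  have hpow : (0 : ℝ) ≤ (1 / 2) ^ n := by positivity
  have hε2 : 0 < ε ^ 2 := by positivity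
  have hwt : ∀ i, 0 ≤ listedWeight edge w i := by
    intro i
    unfold listedWeight
    split_ifs with h
    · refine hw _ ?_
      rw [he.edgeFinset_eq]
      exact Finset.mem_image_of_mem _ (Finset.mem_univ _)
    · rfl
  have hWsum : ∑ i ∈ Finset.range m, listedWeight edge w i = W := by
    rw [hW, he.edgeFinset_eq, Finset.sum_image fun a _ b _ h => he.1 h, Finset.sum_range]
    simp [listedWeight]
  have hW0 : 0 ≤ W := Finset.sum_nonneg hw
  by_cases hcase : ε < 1 / 2 ∧ 4096 * n < m * ε ^ 2 ∧ 0 < W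
  · obtain ⟨hlt, hc, hWpos⟩ := hcase
    have hm : 0 < m := by
      rcases m.eq_zero_or_pos with rfl | h
      · simp at hWsum
        linarith
      · exact h
    have hn : 0 < n := (edge ⟨0, hm⟩).1.pos
    have hn' : (1 : ℝ) ≤ n := by exact_mod_cast hn
    have hm' : (1 : ℝ) ≤ m := by exact_mod_cast hm
    have hkm : k ≤ m := by
      rw [hk, Nat.ceil_le, div_le_iff₀ hε2]
      exact hc.le
    -- From `4096 n < m ε²` and `n, m ≥ 1` comes `m ε ≥ 64`; with `2 ^ m ≥ m`, the `2 m` coins then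
    -- suffice for a bias of at most `ε / 24`.
    have hbias : (m : ℝ) ≤ ε / 6 / 4 * 2 ^ (2 * m) := by
      have h1 : (m : ℝ) ≤ 2 ^ m := by exact_mod_cast Nat.lt_two_pow_self.le
      have h2 : 64 ≤ m * ε := by
        refine le_of_sq_le_sq ?_ (by positivity)
        nlinarith
      have h3 : (m : ℝ) * m ≤ 2 ^ m * 2 ^ m := by gcongr
      rw [two_mul, pow_add]
      nlinarith
    have hT : k * (2 * m) ≤ 100 * (n + m + 1) ^ 2 := by nlinarith [Nat.mul_le_mul_right m hkm]
    have hprob := coinProb_sample_ge hwt hWsum hWpos (t := ε / 6) (by positivity) (by linarith)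
      hbias hT (listedSign edge) abs_listedSign_le
    -- Here `k ε² / (36 · 32) ≥ 4096 n / 1152 ≥ 3 n`, which is what fixes the constant `4096`.
    have htail : 2 * (2 : ℝ) ^ n * Real.exp (-(k * (ε / 6) ^ 2 / 32)) ≤ (1 / 2) ^ n := by
      refine two_mul_two_pow_mul_exp_le hn ?_
      have := Nat.le_ceil (4096 * n / ε ^ 2)
      rw [← hk, div_le_iff₀ hε2] at this
      linarith
    have hcard : (Fintype.card (Fin n → Bool) : ℝ) = 2 ^ n := by simp
    rw [hcard] at hprob
    refine (by linarith : 1 - (1 / 2 : ℝ) ^ n ≤ _).trans (hprob.trans (coinProb_mono ?_))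
    intro coins hgood
    obtain ⟨t, s, -, hrun, hout⟩ := reaches_output edge w hε coins
    refine ⟨t, s, hrun, isSparsification_of_output he hw hε hk hout fun _ _ x => ?_⟩
    have h1 := mul_le_mul_of_nonneg_left (hgood x) hW0
    rw [← abs_of_nonneg hW0, ← abs_mul, abs_of_nonneg hW0, mul_sub, mul_left_comm,
      mul_div_cancel₀ _ hWpos.ne'] at h1
    exact h1.trans (le_of_eq (by ring))
  -- Without sampling, or when `W = 0`, the output is valid for every coin sequence; in the latter
  -- case all listed weights vanish.
  · rw [coinProb_of_forall]
    · linarith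
    intro coins
    obtain ⟨t, s, -, hrun, hout⟩ := reaches_output edge w hε coins
    refine ⟨t, s, hrun, isSparsification_of_output he hw hε hk hout fun h1 h2 x => ?_⟩
    have hWz : W = 0 := le_antisymm (not_lt.mp fun h => hcase ⟨h1, h2, h⟩) hW0
    have hz : ∀ i ∈ Finset.range m, listedWeight edge w i = 0 := by
      rw [← Finset.sum_eq_zero_iff_of_nonneg fun i _ => hwt i, hWsum, hWz]
    have hz' : ∑ i ∈ Finset.range m, listedWeight edge w i * listedSign edge x i = 0 :=
      Finset.sum_eq_zero fun i hi => by rw [hz i hi, zero_mul]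
    rw [← hW, hWz, hz']
    simp

theorem exists_listsEdges (G : SimpleGraph (Fin n)) [DecidableRel G.Adj] :
    ∃ edge : Fin G.edgeFinset.card → Fin n × Fin n, ListsEdges G edge := by
  let f := fun i => (G.edgeFinset.equivFin.symm i : Sym2 (Fin n))
  have h : (fun i => s((f i).out.1, (f i).out.2)) = f := funext fun i => Quot.out_eq (f i)
  refine ⟨fun i => (f i).out, ?_, ?_⟩
  · rw [h]
    exact Subtype.val_injective.comp (Equiv.injective _)
  · rw [h]
    ext e
    rw [← SimpleGraph.mem_edgeFinset]
    constructor
    · rintro ⟨i, rfl⟩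
      exact (G.edgeFinset.equivFin.symm i).2
    · intro he
      exact ⟨G.edgeFinset.equivFin ⟨e, he⟩, by simp [f]⟩

/-- The probabilistic method: a success probability of at least `1 - 2 ^ (-n) > 0` rules out that no
output is valid. For `n = 0` this bound is void, but there are no edges. -/
theorem exists_isSparsification [DecidableRel G.Adj] (hw : ∀ e ∈ G.edgeFinset, 0 ≤ w e)
    (hε : 0 < ε) : ∃ (L : Finset (Sym2 (Fin n))) (w' : Sym2 (Fin n) → ℝ),
      IsSparsification 5000 ε G.edgeFinset w L w' := by
  rcases n.eq_zero_or_pos with rfl | hn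
  · refine ⟨_, w, isSparsification_self hε not_isDiag_of_mem_edgeFinset hw (fun _ _ => rfl) ?_⟩
    simp [Subsingleton.elim G ⊥]
  · obtain ⟨edge, he⟩ := exists_listsEdges G
    have h1 := le_coinProb_isSparsification he hw hε
    by_contra hno
    have h2 : ∀ coins : ℕ → Bool, ¬ ∃ (t : ℕ) (s : Store),
        Runs sparsifyProgram (initStore edge w ε coins) t s ∧
          IsSparsification 5000 ε G.edgeFinset w (outEdges edge s) (outWeights edge s) :=
      fun coins ⟨_, _, _, h⟩ => hno ⟨_, _, h⟩
    simp only [h2, coinProb, Finset.filter_false, Finset.card_empty, Nat.cast_zero,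
      zero_div] at h1
    have h3 : (1 / 2 : ℝ) ^ n < 1 := pow_lt_one₀ (by norm_num) (by norm_num) hn.ne'
    linarith

end

end QMaxCut

end

theorem mainTheorem5 :
    ∃ (C : ℝ) (P : QMaxCut.Program) (A d : ℕ), 0 < C ∧
      ∀ (n : ℕ) (G : SimpleGraph (Fin n)) [DecidableRel G.Adj] (w : Sym2 (Fin n) → ℝ),
        (∀ e ∈ G.edgeFinset, 0 ≤ w e) →
        ∀ ε : ℝ, 0 < ε →
          (∃ (L : Finset (Sym2 (Fin n))) (w' : Sym2 (Fin n) → ℝ),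
            QMaxCut.IsSparsification C ε G.edgeFinset w L w') ∧
          ∀ (m : ℕ) (edge : Fin m → Fin n × Fin n), QMaxCut.ListsEdges G edge →
            (∀ coins : ℕ → Bool, ∃ (t : ℕ) (s : QMaxCut.Store),
              t ≤ A * (n + m + 1) ^ d ∧
                QMaxCut.Runs P (QMaxCut.initStore edge w ε coins) t s) ∧
            1 - (1 / 2 : ℝ) ^ n ≤
              QMaxCut.coinProb (A * (n + m + 1) ^ d) fun coins =>
                ∃ (t : ℕ) (s : QMaxCut.Store),
                  QMaxCut.Runs P (QMaxCut.initStore edge w ε coins) t s ∧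
                    QMaxCut.IsSparsification C ε G.edgeFinset w
                      (QMaxCut.outEdges edge s) (QMaxCut.outWeights edge s) := by
  refine ⟨5000, QMaxCut.sparsifyProgram, 100, 2, by norm_num, ?_⟩
  intro n G _ w hw ε hε
  refine ⟨QMaxCut.exists_isSparsification hw hε, fun m edge he => ⟨fun coins => ?_,
    QMaxCut.le_coinProb_isSparsification he hw hε⟩⟩
  obtain ⟨t, s, ht, hr, -⟩ := QMaxCut.reaches_output edge w hε coins
  exact ⟨t, s, ht, hr⟩
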